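/- Let $N\ge 2$ be an integer and $\beta\in(1/(2N-1),1/N)$. A set $\Gamma\subseteq\mathbb R$ is called self-similar if it is nonempty and compact and $\Gamma=\bigcup_{i=1}^p f_i(\Gamma)$ for some finite family of maps $f_i(x)=r_ix+b_i$ on $\mathbb R$ with $0<|r_i|<1$. Let $$\Gamma_{\beta,N}=\Big\{\sum_{\ell=1}^\infty \frac{j_\ell\,\beta^{\ell-1}(1-\beta)}{N-1} : j_\ell\in\{0,1,\dots,N-1\}\Big\}$$ be the $N$-part homogeneous Cantor set, that is, the self-similar set generated by the maps $x\mapsto \beta x+d(1-\beta)/(N-1)$, $d=0,1,\dots,N-1$. A code of $t\in\mathbb R$ is a sequence $(t_\ell)_{\ell\ge1}$ with $t_\ell\in\{0,\pm1,\dots,\pm(N-1)\}$ and $t=\sum_{\ell=1}^\infty t_\ell\,\beta^{\ell-1}(1-\beta)/(N-1)$. Let $\mathcal S_{\beta,\pm N}$ be the set of all $t\in[-1,1]$ that have exactly one code and for which $\Gamma_{\beta,N}\cap(\Gamma_{\beta,N}+t)$ is a self-similar set. Put $$\alpha_c=\frac{N+1-\sqrt{(N-1)(N+3)}}{2}.$$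 (1) If $\beta\in(1/(2N-1),\alpha_c)$, then $\dim_H\mathcal S_{\beta,\pm N}>0$, where $\dim_H$ is the Hausdorff dimension. (2) If $\beta\in[\alpha_c,1/N)$, then $\mathcal S_{\beta,\pm N}$ is countably infinite, i.e. $|\mathcal S_{\beta,\pm N}|=\aleph_0$. -/

import Mathlib

namespace HomCantor

/-- The nonempty compact set `Γ ⊆ ℝ` is generated by the iterated function system
`f i x = r i * x + b i`, that is, `Γ = ⋃ i, f i (Γ)`. -/
def IsGeneratedBy {ι : Type*} (r b : ι → ℝ) (Γ : Set ℝ) : Prop :=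
  Γ.Nonempty ∧ IsCompact Γ ∧ Γ = ⋃ i, (fun x => r i * x + b i) '' Γ

/-- `Γ ⊆ ℝ` is a self-similar set: it is generated by some finite family of affine maps
`f i x = r i * x + b i` with `0 < |r i| < 1`. -/
def IsSelfSimilar (Γ : Set ℝ) : Prop :=
  ∃ (p : ℕ) (r b : Fin p → ℝ), (∀ i, 0 < |r i| ∧ |r i| < 1) ∧ IsGeneratedBy r b Γ

/-- The digit set `{0, 1, …, N - 1}`. -/
def digits (N : ℕ) : Set ℤ := Set.Icc 0 ((N : ℤ) - 1)

/-- The digit set `{0, ±1, …, ±(N - 1)}`. -/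
def pmDigits (N : ℕ) : Set ℤ := Set.Icc (-((N : ℤ) - 1)) ((N : ℤ) - 1)

/-- The value `∑_{ℓ ≥ 1} j_ℓ β^(ℓ-1) (1 - β) / (N - 1)` of a digit string, whose entries are
indexed here from `0`. -/
noncomputable def codeValue (β : ℝ) (N : ℕ) (j : ℕ → ℤ) : ℝ :=
  ∑' l : ℕ, (j l : ℝ) * β ^ l * (1 - β) / ((N : ℝ) - 1)

/-- `j` is an `Ω`-code of the real number `t`. -/
def IsCode (β : ℝ) (N : ℕ) (Ω : Set ℤ) (t : ℝ) (j : ℕ → ℤ) : Prop :=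
  (∀ l, j l ∈ Ω) ∧ codeValue β N j = t

/-- The `N`-part homogeneous Cantor set, as the set of all reals that have a code with digits
in `{0, …, N - 1}`; see `cantorSet_isGeneratedBy` and `eq_cantorSet_of_isGeneratedBy` for its
description by the maps `x ↦ β x + d (1 - β) / (N - 1)`. -/
def cantorSet (β : ℝ) (N : ℕ) : Set ℝ := {x | ∃ j, IsCode β N (digits N) x j}

/-- The set of `t ∈ [-1, 1]` with exactly one code with digits in `{0, ±1, …, ±(N - 1)}`. -/
def uniqueCodeSet (β : ℝ) (N : ℕ) : Set ℝ :=
  {t | t ∈ Set.Icc (-1 : ℝ) 1 ∧ ∃! j, IsCode β N (pmDigits N) t j}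

/-- The set of `t` with a unique code for which the intersection of the Cantor set with its
translate by `t` is a self-similar set. -/
def selfSimilarSet (β : ℝ) (N : ℕ) : Set ℝ :=
  {t | t ∈ uniqueCodeSet β N ∧
    IsSelfSimilar (cantorSet β N ∩ (fun x => x + t) '' cantorSet β N)}

/-- The number `[N + 1 - √((N - 1)(N + 3))] / 2`. -/
noncomputable def alphaC (N : ℕ) : ℝ :=
  ((N : ℝ) + 1 - Real.sqrt (((N : ℝ) - 1) * ((N : ℝ) + 3))) / 2

theorem term_bound {β : ℝ} {N : ℕ} (hN : 2 ≤ N) (h0 : 0 < β) (h1 : β < 1) {j : ℕ → ℤ}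
    (hj : ∀ l, j l ∈ digits N) (l : ℕ) :
    ‖(j l : ℝ) * β ^ l * (1 - β) / ((N : ℝ) - 1)‖ ≤ β ^ l := by
  have hN' : (2 : ℝ) ≤ N := by exact_mod_cast hN
  have ha : (0 : ℝ) ≤ j l := by exact_mod_cast (hj l).1
  have hb : (j l : ℝ) ≤ N - 1 := by exact_mod_cast (hj l).2
  have hp : 0 < β ^ l := pow_pos h0 l
  have h1' : 0 < 1 - β := by linarith
  rw [Real.norm_of_nonneg (by apply div_nonneg <;> first | positivity | linarith),
    div_le_iff₀ (by linarith)]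
  have : (j l : ℝ) * (1 - β) ≤ (N - 1) * 1 :=
    mul_le_mul hb (by linarith) h1'.le (by linarith)
  nlinarith

theorem term_summable {β : ℝ} {N : ℕ} (hN : 2 ≤ N) (h0 : 0 < β) (h1 : β < 1) {j : ℕ → ℤ}
    (hj : ∀ l, j l ∈ digits N) :
    Summable fun l : ℕ => (j l : ℝ) * β ^ l * (1 - β) / ((N : ℝ) - 1) :=
  Summable.of_norm_bounded (summable_geometric_of_lt_one h0.le h1) (term_bound hN h0 h1 hj)

theorem codeValue_shift {β : ℝ} {N : ℕ} (hN : 2 ≤ N) (h0 : 0 < β) (h1 : β < 1) {j : ℕ → ℤ}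
    (hj : ∀ l, j l ∈ digits N) :
    codeValue β N j =
      β * codeValue β N (fun l => j (l + 1)) + (j 0 : ℝ) * (1 - β) / ((N : ℝ) - 1) := by
  unfold codeValue
  rw [(term_summable hN h0 h1 hj).tsum_eq_zero_add, ← tsum_mul_left, add_comm]
  congr 1
  · refine tsum_congr fun l => ?_
    rw [pow_succ]; ring
  · simp

theorem cantorSet_isCompact {β : ℝ} {N : ℕ} (hN : 2 ≤ N) (h0 : 0 < β) (h1 : β < 1) :
    IsCompact (cantorSet β N) := by
  have hc : IsCompact (Set.univ.pi fun _ : ℕ => digits N) :=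
    isCompact_univ_pi fun _ => (Set.finite_Icc _ _).isCompact
  have he : cantorSet β N = codeValue β N '' (Set.univ.pi fun _ : ℕ => digits N) := by
    ext x
    simp [cantorSet, IsCode, Set.mem_image, Set.mem_pi]
  rw [he]
  refine hc.image_of_continuousOn ?_
  unfold codeValue
  refine continuousOn_tsum (u := fun l => β ^ l) ?_ (summable_geometric_of_lt_one h0.le h1) ?_
  · intro l
    have : Continuous fun j : ℕ → ℤ => (j l : ℝ) :=
      continuous_of_discreteTopology.comp (continuous_apply l)
    exact (((this.mul continuous_const).mul continuous_const).div_const _).continuousOn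
  · intro l j hj
    exact term_bound hN h0 h1 (fun l => hj l trivial) l

/-- The homogeneous Cantor set is generated by the maps `x ↦ β x + d (1 - β) / (N - 1)`,
`d ∈ {0, …, N - 1}`. -/
theorem cantorSet_isGeneratedBy {β : ℝ} {N : ℕ} (hN : 2 ≤ N) (h0 : 0 < β) (h1 : β < 1) :
    IsGeneratedBy (fun _ : digits N => β) (fun d => ((d : ℤ) : ℝ) * (1 - β) / ((N : ℝ) - 1))
      (cantorSet β N) := by
  have hz : (0 : ℤ) ∈ digits N := ⟨le_rfl, by omega⟩
  refine ⟨⟨_, fun _ => 0, fun _ => hz, rfl⟩, cantorSet_isCompact hN h0 h1, ?_⟩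
  ext x
  simp only [Set.mem_iUnion, Set.mem_image]
  constructor
  · rintro ⟨j, hj, rfl⟩
    exact ⟨⟨j 0, hj 0⟩, _, ⟨fun l => j (l + 1), fun l => hj _, rfl⟩,
      (codeValue_shift hN h0 h1 hj).symm⟩
  · rintro ⟨d, _, ⟨j, hj, rfl⟩, rfl⟩
    have hj' : ∀ l, (fun l : ℕ => Nat.casesOn l (d : ℤ) j : ℕ → ℤ) l ∈ digits N := by
      intro l
      cases l with
      | zero => exact d.2
      | succ l => exact hj l
    exact ⟨_, hj', codeValue_shift hN h0 h1 hj'⟩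

/-- The homogeneous Cantor set is the only nonempty compact set generated by these maps. -/
theorem eq_cantorSet_of_isGeneratedBy {β : ℝ} {N : ℕ} (hN : 2 ≤ N) (h0 : 0 < β) (h1 : β < 1)
    {K : Set ℝ}
    (hK : IsGeneratedBy (fun _ : digits N => β)
      (fun d => ((d : ℤ) : ℝ) * (1 - β) / ((N : ℝ) - 1)) K) :
    K = cantorSet β N := by
  obtain ⟨⟨y, hy⟩, hKc, hKe⟩ := hK
  obtain ⟨C, hC⟩ := hKc.isBounded.exists_norm_le
  have hlim : Filter.Tendsto (fun n : ℕ => β ^ n * C) Filter.atTop (nhds 0) := by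
    simpa using (tendsto_pow_atTop_nhds_zero_of_lt_one h0.le h1).mul_const C
  ext x
  constructor
  · intro hx
    have hstep : ∀ z : K, ∃ d : digits N, ∃ w : K,
        β * (w : ℝ) + ((d : ℤ) : ℝ) * (1 - β) / ((N : ℝ) - 1) = z := by
      intro z
      have hz : (z : ℝ) ∈ ⋃ d : digits N,
          (fun x => β * x + ((d : ℤ) : ℝ) * (1 - β) / ((N : ℝ) - 1)) '' K := hKe ▸ z.2
      simp only [Set.mem_iUnion, Set.mem_image] at hz
      obtain ⟨d, w, hw, hwz⟩ := hz
      exact ⟨d, ⟨w, hw⟩, hwz⟩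
    choose D W hW using hstep
    have hj : ∀ l, ((D (W^[l] ⟨x, hx⟩) : digits N) : ℤ) ∈ digits N := fun l => Subtype.coe_prop _
    refine ⟨fun l => D (W^[l] ⟨x, hx⟩), hj, ?_⟩
    have hsum : ∀ n : ℕ, x = ∑ l ∈ Finset.range n,
        (((D (W^[l] ⟨x, hx⟩) : digits N) : ℤ) : ℝ) * β ^ l * (1 - β) / ((N : ℝ) - 1)
        + β ^ n * (W^[n] ⟨x, hx⟩ : K) := by
      intro n
      induction n with
      | zero => simp
      | succ n ih =>
        rw [Finset.sum_range_succ, Function.iterate_succ_apply']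
        conv_lhs => rw [ih, ← hW (W^[n] ⟨x, hx⟩)]
        rw [pow_succ]; ring
    have ht := (term_summable hN h0 h1 hj).hasSum.tendsto_sum_nat
    have hr : Filter.Tendsto (fun n : ℕ => β ^ n * ((W^[n] ⟨x, hx⟩ : K) : ℝ))
        Filter.atTop (nhds 0) := by
      refine squeeze_zero_norm (fun n => ?_) hlim
      rw [norm_mul, Real.norm_of_nonneg (pow_pos h0 n).le]
      exact mul_le_mul_of_nonneg_left (hC _ (Subtype.coe_prop _)) (pow_pos h0 n).le
    have ha := ht.add hr
    rw [add_zero] at ha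
    refine tendsto_nhds_unique ha ?_
    simp_rw [← hsum]
    exact tendsto_const_nhds
  · rintro ⟨j, hj, rfl⟩
    have hmem : ∀ (n : ℕ) (i : ℕ → ℤ), (∀ l, i l ∈ digits N) →
        ∑ l ∈ Finset.range n, (i l : ℝ) * β ^ l * (1 - β) / ((N : ℝ) - 1) + β ^ n * y ∈ K := by
      intro n
      induction n with
      | zero => intro i _; simpa using hy
      | succ n ih =>
        intro i hi
        rw [hKe]
        refine Set.mem_iUnion.2 ⟨⟨i 0, hi 0⟩, _, ih (fun l => i (l + 1)) (fun l => hi _), ?_⟩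
        simp only
        rw [Finset.sum_range_succ', mul_add, Finset.mul_sum]
        have : ∀ l : ℕ, β * ((i (l + 1) : ℝ) * β ^ l * (1 - β) / ((N : ℝ) - 1)) =
            (i (l + 1) : ℝ) * β ^ (l + 1) * (1 - β) / ((N : ℝ) - 1) := by
          intro l; rw [pow_succ]; ring
        simp_rw [this]
        rw [pow_succ]; ring
    have ht := (term_summable hN h0 h1 hj).hasSum.tendsto_sum_nat
    have hr : Filter.Tendsto (fun n : ℕ => β ^ n * y) Filter.atTop (nhds 0) := by
      simpa using (tendsto_pow_atTop_nhds_zero_of_lt_one h0.le h1).mul_const y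
    have ha := ht.add hr
    rw [add_zero] at ha
    exact hKc.isClosed.mem_of_tendsto ha (Filter.Eventually.of_forall fun n => hmem n j hj)

end HomCantor

/-!
# Self-similar intersections of a homogeneous Cantor set with its translates

Write a code as a digit string `a`, let `V n` (`tailValue β a n`) be the value of the string without
its first `n` digits, and let `gap β N = 1 - (N - 1) β / (1 - β)`. Since `β > 1 / (2N - 1)`, every
number in the possible range has a code, so a code is unique exactly when no digit can be raised or
lowered by `1`: a digit below `N - 1` at place `n` needs `β * V (n + 1) < gap β N`, and a digit above
`-(N - 1)` needs `-gap β N < β * V (n + 1)` (`isUniqueCode_of_lt_gap`, `IsUniqueCode.lt_gap`). For a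
unique code `a` of `t`, the intersection of the Cantor set with its translate by `t` is an affine
image of the set `boundedDigitSet` of all `∑ d l * β ^ l` with `0 ≤ d l ≤ N - 1 - |a l|`
(`inter_translate_eq`), so only the absolute values of the digits matter for self-similarity. The
critical base is the one with `gap β N = β` (`lt_alphaC_iff`).

Below the critical base, isolated digits `±1` in an otherwise zero code are harmless if they are
far enough apart. Placing them at the multiples of a large period, with arbitrary signs, gives
unique codes with periodic absolute values; their numbers form a Cantor set, whose dimension is
positive because it maps onto `[0, 1)` by a Hölder map (`dimH_range_pos`).

From the critical base on, the codes `N - 1, …, N - 1, 0, 0, …` still give infinitely many members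
(`selfSimilarSet_infinite`). Countability has two ingredients.

* If `E = boundedDigitSet β m` is self-similar, then `r * E ⊆ E` for some `r ∈ (0, 1)`, by the
  symmetry of `E`. Then `r ^ k * β ^ l ∈ E` for all `k` and some `l`, unless `m = 0`. But the leading
  digit keeps the points of `E` out of gaps that are repeated at all scales `β ^ j`, so
  `log r / log β` is rational by Dirichlet's approximation theorem, and `β ^ p * E ⊆ E` for some
  `p ≥ 1`. Comparing digits, `m l ≤ m (l + p)`, hence `m` is eventually periodic
  (`natAbs_mem_eventuallyPeriodic`).
* If `gap β N ≤ β`, then after the first place with `|β * V n| < gap β N` the nonzero digits are `±1`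
  with alternating signs, and the sign of `V n` fixes the first of them. So finitely much
  information besides the absolute values determines the code (`IsUniqueCode.eq_of_natAbs_eq`).
  A unique code without such a place is constantly `N - 1` or constantly `-(N - 1)`
  (`IsUniqueCode.exists_short_tail`).
-/

namespace HomCantor

/-! ### Digit series -/

/-- The value `∑ l, a (n + l) * β ^ l` of the digit string `a` with its first `n` entries removed;
`n = 0` gives the value of `a` itself. -/
noncomputable def tailValue (β : ℝ) (a : ℕ → ℤ) (n : ℕ) : ℝ :=
  ∑' l : ℕ, (a (n + l) : ℝ) * β ^ l

/-- The number `1 - (N - 1) β / (1 - β)`. A digit `d` followed by a tail worth `T` can be replaced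
by `d + 1` exactly when `T - 1` is still the worth of a tail, that is, when `T` is at least this
number. -/
noncomputable def gap (β : ℝ) (N : ℕ) : ℝ := (1 - N * β) / (1 - β)

section DigitSeries

variable {β : ℝ} {N : ℕ} {a b : ℕ → ℤ}

theorem beta_lt_one (hN : 2 ≤ N) (h1 : N * β < 1) : β < 1 := by
  have hN' : (2 : ℝ) ≤ N := by exact_mod_cast hN
  nlinarith

theorem gap_pos (hN : 2 ≤ N) (h1 : N * β < 1) : 0 < gap β N :=
  div_pos (by linarith) (by linarith [beta_lt_one hN h1])

theorem mul_radius (hN : 2 ≤ N) (h1 : N * β < 1) :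
    β * (((N : ℝ) - 1) / (1 - β)) = 1 - gap β N := by
  have := beta_lt_one hN h1
  have h : 1 - β ≠ 0 := by linarith
  rw [gap]
  field_simp
  ring

theorem gap_lt_one (hN : 2 ≤ N) (h0 : 0 < β) (h1 : N * β < 1) : gap β N < 1 := by
  have hN' : (2 : ℝ) ≤ N := by exact_mod_cast hN
  have := mul_radius hN h1
  have : 0 < β * (((N : ℝ) - 1) / (1 - β)) :=
    mul_pos h0 (div_pos (by linarith) (by linarith [beta_lt_one hN h1]))
  linarith

theorem digits_subset_pmDigits : digits N ⊆ pmDigits N := by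
  intro d hd
  simp only [digits, pmDigits, Set.mem_Icc] at *
  omega

theorem abs_le_of_mem_pmDigits {d : ℤ} (h : d ∈ pmDigits N) : |(d : ℝ)| ≤ (N : ℝ) - 1 := by
  have : |d| ≤ (N : ℤ) - 1 := abs_le.2 h
  exact_mod_cast this

theorem tail_summable (h0 : 0 < β) (h1 : β < 1) (ha : ∀ l, a l ∈ pmDigits N) (n : ℕ) :
    Summable fun l : ℕ => (a (n + l) : ℝ) * β ^ l := by
  refine Summable.of_norm_bounded
    ((summable_geometric_of_lt_one h0.le h1).mul_left ((N : ℝ) - 1)) fun l => ?_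
  rw [norm_mul, Real.norm_eq_abs, norm_pow, Real.norm_of_nonneg h0.le]
  exact mul_le_mul_of_nonneg_right (abs_le_of_mem_pmDigits (ha _)) (by positivity)

theorem tailValue_eq (h0 : 0 < β) (h1 : β < 1) (ha : ∀ l, a l ∈ pmDigits N) (n : ℕ) :
    tailValue β a n = a n + β * tailValue β a (n + 1) := by
  unfold tailValue
  rw [(tail_summable h0 h1 ha n).tsum_eq_zero_add, ← tsum_mul_left]
  congr 1
  · simp
  · refine tsum_congr fun l => ?_
    rw [pow_succ, show n + (l + 1) = n + 1 + l by ring]; ring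

theorem abs_tailValue_le (h0 : 0 < β) (h1 : β < 1) (ha : ∀ l, a l ∈ pmDigits N) (n : ℕ) :
    |tailValue β a n| ≤ ((N : ℝ) - 1) / (1 - β) := by
  have hs := (summable_geometric_of_lt_one h0.le h1).mul_left ((N : ℝ) - 1)
  have : ‖tailValue β a n‖ ≤ ∑' l : ℕ, ((N : ℝ) - 1) * β ^ l := by
    refine tsum_of_norm_bounded hs.hasSum fun l => ?_
    rw [norm_mul, Real.norm_eq_abs, norm_pow, Real.norm_of_nonneg h0.le]
    exact mul_le_mul_of_nonneg_right (abs_le_of_mem_pmDigits (ha _)) (by positivity)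
  rwa [tsum_mul_left, tsum_geometric_of_lt_one h0.le h1, ← div_eq_mul_inv] at this

theorem abs_mul_tailValue_le (hN : 2 ≤ N) (h0 : 0 < β) (h1 : N * β < 1)
    (ha : ∀ l, a l ∈ pmDigits N) (n : ℕ) : |β * tailValue β a n| ≤ 1 - gap β N := by
  rw [abs_mul, abs_of_pos h0, ← mul_radius hN h1]
  exact mul_le_mul_of_nonneg_left (abs_tailValue_le h0 (beta_lt_one hN h1) ha n) h0.le

theorem tailValue_nonneg (h0 : 0 < β) (ha : ∀ l, 0 ≤ a l) (n : ℕ) : 0 ≤ tailValue β a n :=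
  tsum_nonneg fun l => mul_nonneg (by exact_mod_cast ha _) (by positivity)

theorem tailValue_neg (n : ℕ) : tailValue β (fun l => -a l) n = -tailValue β a n := by
  simp [tailValue, tsum_neg]

theorem tailValue_add (h0 : 0 < β) (h1 : β < 1) {M : ℕ} (ha : ∀ l, a l ∈ pmDigits N)
    (hb : ∀ l, b l ∈ pmDigits M) (n : ℕ) :
    tailValue β (fun l => a l + b l) n = tailValue β a n + tailValue β b n := by
  unfold tailValue
  rw [← (tail_summable h0 h1 ha n).tsum_add (tail_summable h0 h1 hb n)]
  refine tsum_congr fun l => ?_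
  push_cast; ring

theorem neg_mem_pmDigits {d : ℤ} (h : d ∈ pmDigits N) : -d ∈ pmDigits N := by
  simp only [pmDigits, Set.mem_Icc] at *
  omega

theorem tailValue_shift (k n : ℕ) :
    tailValue β (fun l => a (k + l)) n = tailValue β a (k + n) := by
  simp [tailValue, add_assoc]

theorem codeValue_eq (a : ℕ → ℤ) :
    codeValue β N a = (1 - β) / ((N : ℝ) - 1) * tailValue β a 0 := by
  unfold codeValue tailValue
  rw [← tsum_mul_left]
  refine tsum_congr fun l => ?_
  rw [zero_add]; ring

theorem scale_pos (hN : 2 ≤ N) (h1 : β < 1) : 0 < (1 - β) / ((N : ℝ) - 1) := by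
  have hN' : (2 : ℝ) ≤ N := by exact_mod_cast hN
  exact div_pos (by linarith) (by linarith)

theorem tailValue_zero_congr (h0 : 0 < β) (h1 : β < 1) (ha : ∀ l, a l ∈ pmDigits N)
    (hb : ∀ l, b l ∈ pmDigits N) (n : ℕ) (hab : ∀ l < n, a l = b l)
    (h : tailValue β a n = tailValue β b n) : tailValue β a 0 = tailValue β b 0 := by
  induction n with
  | zero => exact h
  | succ n ih =>
    refine ih (fun l hl => hab l (by omega)) ?_
    rw [tailValue_eq h0 h1 ha, tailValue_eq h0 h1 hb, h, hab n (by omega)]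

/-- Below base `1 / N` a string with digits in `{0, …, N - 1}` is determined by its value. -/
theorem digits_ext (hN : 2 ≤ N) (h0 : 0 < β) (h1 : N * β < 1) (ha : ∀ l, a l ∈ digits N)
    (hb : ∀ l, b l ∈ digits N) (h : tailValue β a 0 = tailValue β b 0) : a = b := by
  have hβ := beta_lt_one hN h1
  have ha' := fun l => digits_subset_pmDigits (ha l)
  have hb' := fun l => digits_subset_pmDigits (hb l)
  have hg := gap_pos hN h1
  have step : ∀ n, tailValue β a n = tailValue β b n → a n = b n := by
    intro n hn
    rw [tailValue_eq h0 hβ ha', tailValue_eq h0 hβ hb'] at hn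
    have h3 := abs_le.1 (abs_mul_tailValue_le hN h0 h1 ha' (n + 1))
    have h4 := abs_le.1 (abs_mul_tailValue_le hN h0 h1 hb' (n + 1))
    have h5 := mul_nonneg h0.le (tailValue_nonneg h0 (fun l => (ha l).1) (n + 1))
    have h6 := mul_nonneg h0.le (tailValue_nonneg h0 (fun l => (hb l).1) (n + 1))
    have h7 : (a n : ℝ) < b n + 1 := by linarith [h4.2]
    have h8 : (b n : ℝ) < a n + 1 := by linarith [h3.2]
    have h7' : a n < b n + 1 := by exact_mod_cast h7
    have h8' : b n < a n + 1 := by exact_mod_cast h8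
    omega
  have all : ∀ n, tailValue β a n = tailValue β b n := by
    intro n
    induction n with
    | zero => exact h
    | succ n ih =>
      have := step n ih
      rw [tailValue_eq h0 hβ ha', tailValue_eq h0 hβ hb', this] at ih
      exact mul_left_cancel₀ h0.ne' (add_left_cancel ih)
  exact funext fun n => step n (all n)

/-- Every real number of modulus at most `(N - 1) / (1 - β)` is the value of a string with digits
in `{0, ±1, …, ±(N - 1)}`, because `β ≥ 1 / (2N - 1)`. -/
theorem exists_tailValue_eq (hN : 2 ≤ N) (h0 : 0 < β) (h1 : N * β < 1)
    (h2 : 1 < (2 * (N : ℝ) - 1) * β) {x : ℝ} (hx : |x| ≤ ((N : ℝ) - 1) / (1 - β)) :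
    ∃ a : ℕ → ℤ, (∀ l, a l ∈ pmDigits N) ∧ tailValue β a 0 = x := by
  have hβ := beta_lt_one hN h1
  have hN' : (2 : ℝ) ≤ N := by exact_mod_cast hN
  set R := ((N : ℝ) - 1) / (1 - β) with hR
  have hR' : R = N - 1 + β * R := by
    rw [hR]; field_simp [show 1 - β ≠ 0 by linarith]; ring
  have hhalf : 1 / 2 ≤ β * R := by
    have : β * R * (1 - β) = β * (N - 1) := by
      rw [hR]; field_simp [show 1 - β ≠ 0 by linarith]
    nlinarith
  have hstep : ∀ z : Set.Icc (-R) R, ∃ d : pmDigits N, ∃ w : Set.Icc (-R) R,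
      (z : ℝ) = (d : ℤ) + β * w := by
    rintro ⟨z, hz1, hz2⟩
    suffices ∃ d ∈ pmDigits N, |z - (d : ℝ)| ≤ β * R by
      obtain ⟨d, hd, hzd⟩ := this
      have hzd' := abs_le.1 hzd
      refine ⟨⟨d, hd⟩, ⟨(z - d) / β, ?_, ?_⟩, ?_⟩
      · rw [le_div_iff₀ h0]; linarith
      · rw [div_le_iff₀ h0]; linarith
      · simp only; field_simp; ring
    by_cases hb : (N : ℝ) - 1 / 2 ≤ z
    · refine ⟨(N : ℤ) - 1, ⟨by omega, le_rfl⟩, abs_le.2 ?_⟩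
      push_cast
      constructor <;> linarith
    by_cases hc : z ≤ -((N : ℝ) - 1 / 2)
    · refine ⟨-((N : ℤ) - 1), ⟨le_rfl, by omega⟩, abs_le.2 ?_⟩
      push_cast
      constructor <;> linarith
    · push Not at hb hc
      have hr := abs_sub_round z
      have hr' := abs_le.1 hr
      have hu : (round z : ℝ) < N := by linarith
      have hl : -(N : ℝ) < round z := by linarith
      have hu' : round z < (N : ℤ) := by exact_mod_cast hu
      have hl' : -(N : ℤ) < round z := by exact_mod_cast hl
      exact ⟨round z, ⟨by omega, by omega⟩, hr.trans hhalf⟩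
  choose D W hW using hstep
  have hxm : x ∈ Set.Icc (-R) R := abs_le.1 hx
  have ha : ∀ l, ((D (W^[l] ⟨x, hxm⟩) : pmDigits N) : ℤ) ∈ pmDigits N := fun l => Subtype.coe_prop _
  refine ⟨fun l => D (W^[l] ⟨x, hxm⟩), ha, ?_⟩
  have hsum : ∀ n : ℕ, x = ∑ l ∈ Finset.range n,
      (((D (W^[l] ⟨x, hxm⟩) : pmDigits N) : ℤ) : ℝ) * β ^ l +
        β ^ n * (W^[n] ⟨x, hxm⟩ : Set.Icc (-R) R) := by
    intro n
    induction n with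
    | zero => simp
    | succ n ih =>
      rw [Finset.sum_range_succ, Function.iterate_succ_apply']
      conv_lhs => rw [ih, hW (W^[n] ⟨x, hxm⟩)]
      rw [pow_succ]; ring
  have ht := (tail_summable h0 hβ ha 0).hasSum.tendsto_sum_nat
  have hr : Filter.Tendsto (fun n : ℕ => β ^ n * ((W^[n] ⟨x, hxm⟩ : Set.Icc (-R) R) : ℝ))
      Filter.atTop (nhds 0) := by
    have hlim : Filter.Tendsto (fun n : ℕ => β ^ n * R) Filter.atTop (nhds 0) := by
      simpa using (tendsto_pow_atTop_nhds_zero_of_lt_one h0.le hβ).mul_const R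
    refine squeeze_zero_norm (fun n => ?_) hlim
    rw [norm_mul, Real.norm_of_nonneg (pow_pos h0 n).le]
    exact mul_le_mul_of_nonneg_left (abs_le.2 (Subtype.coe_prop (W^[n] ⟨x, hxm⟩)))
      (pow_pos h0 n).le
  have hadd := ht.add hr
  rw [add_zero] at hadd
  refine tendsto_nhds_unique hadd ?_
  refine Filter.Tendsto.congr (f₁ := fun _ => x) (fun n => ?_) tendsto_const_nhds
  simpa only [zero_add] using hsum n

/-! ### Unique codes -/

/-- `a` is a string with digits in `{0, ±1, …, ±(N - 1)}`, and the only one with its value. -/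
def IsUniqueCode (β : ℝ) (N : ℕ) (a : ℕ → ℤ) : Prop :=
  (∀ l, a l ∈ pmDigits N) ∧
    ∀ b : ℕ → ℤ, (∀ l, b l ∈ pmDigits N) → tailValue β b 0 = tailValue β a 0 → b = a

theorem IsUniqueCode.neg (ha : IsUniqueCode β N a) : IsUniqueCode β N fun l => -a l := by
  refine ⟨fun l => neg_mem_pmDigits (ha.1 l), fun b hb hab => ?_⟩
  have h : (fun l => -b l) = a := by
    refine ha.2 _ (fun l => neg_mem_pmDigits (hb l)) ?_
    rw [tailValue_neg, hab, tailValue_neg, neg_neg]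
  funext l
  have := congrFun h l
  omega

theorem isUniqueCode_of_lt_gap (hN : 2 ≤ N) (h0 : 0 < β) (h1 : N * β < 1)
    (ha : ∀ l, a l ∈ pmDigits N)
    (hu : ∀ n, a n < (N : ℤ) - 1 → β * tailValue β a (n + 1) < gap β N)
    (hl : ∀ n, -((N : ℤ) - 1) < a n → -gap β N < β * tailValue β a (n + 1)) :
    IsUniqueCode β N a := by
  refine ⟨ha, fun b hb hab => ?_⟩
  have hβ := beta_lt_one hN h1
  have step : ∀ n, tailValue β b n = tailValue β a n → b n = a n := by
    intro n hn
    rw [tailValue_eq h0 hβ ha, tailValue_eq h0 hβ hb] at hn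
    have h3 := abs_le.1 (abs_mul_tailValue_le hN h0 h1 hb (n + 1))
    rcases lt_trichotomy (b n) (a n) with h | h | h
    · have h4 := hl n (lt_of_le_of_lt (hb n).1 h)
      have h5 : (b n : ℝ) + 1 ≤ a n := by exact_mod_cast h
      linarith [h3.2]
    · exact h
    · have h4 := hu n (lt_of_lt_of_le h (hb n).2)
      have h5 : (a n : ℝ) + 1 ≤ b n := by exact_mod_cast h
      linarith [h3.1]
  have all : ∀ n, tailValue β b n = tailValue β a n := by
    intro n
    induction n with
    | zero => exact hab
    | succ n ih =>
      have := step n ih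
      rw [tailValue_eq h0 hβ ha, tailValue_eq h0 hβ hb, this] at ih
      exact mul_left_cancel₀ h0.ne' (add_left_cancel ih)
  exact funext fun n => step n (all n)

/-- If the tail were at least `gap`, the digit before it could be raised by `1` and the tail
recoded to compensate. -/
theorem IsUniqueCode.lt_gap (hN : 2 ≤ N) (h0 : 0 < β) (h1 : N * β < 1)
    (h2 : 1 < (2 * (N : ℝ) - 1) * β) (ha : IsUniqueCode β N a) {n : ℕ} (hn : a n < (N : ℤ) - 1) :
    β * tailValue β a (n + 1) < gap β N := by
  by_contra! hge
  have hβ := beta_lt_one hN h1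
  have hg := gap_pos hN h1
  have hle := abs_le.1 (abs_mul_tailValue_le hN h0 h1 ha.1 (n + 1))
  set y := tailValue β a (n + 1) - 1 / β with hy
  have hβy : β * y = β * tailValue β a (n + 1) - 1 := by
    rw [hy]; field_simp
  have hyR : |y| ≤ ((N : ℝ) - 1) / (1 - β) := by
    rw [← mul_le_mul_iff_of_pos_left h0, mul_radius hN h1]
    have : β * |y| = |β * y| := by rw [abs_mul, abs_of_pos h0]
    rw [this, hβy, abs_le]
    constructor <;> linarith [hle.1, hle.2, gap_lt_one hN h0 h1]
  obtain ⟨e, he, hey⟩ := exists_tailValue_eq hN h0 h1 h2 hyR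
  set b : ℕ → ℤ := fun l => if l < n then a l else if l = n then a n + 1 else e (l - (n + 1))
    with hb
  have hbn : b n = a n + 1 := by simp [hb]
  have hbm : ∀ l, b l ∈ pmDigits N := by
    intro l
    simp only [hb]
    split_ifs
    · exact ha.1 l
    · have := (ha.1 n).1
      exact ⟨by omega, by omega⟩
    · exact he _
  have hbt : tailValue β b (n + 1) = y := by
    rw [← hey]
    unfold tailValue
    refine tsum_congr fun l => ?_
    have h3 : ¬ (n + 1 + l < n) := by omega
    have h4 : ¬ (n + 1 + l = n) := by omega
    simp only [hb, if_neg h3, if_neg h4]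
    rw [show n + 1 + l - (n + 1) = 0 + l by omega]
  have hval : tailValue β b 0 = tailValue β a 0 := by
    refine tailValue_zero_congr h0 hβ hbm ha.1 n (fun l hl => by simp [hb, hl]) ?_
    rw [tailValue_eq h0 hβ hbm, tailValue_eq h0 hβ ha.1, hbt, hβy, hbn]
    push_cast; ring
  have := congrFun (ha.2 b hbm hval) n
  omega

theorem IsUniqueCode.neg_gap_lt (hN : 2 ≤ N) (h0 : 0 < β) (h1 : N * β < 1)
    (h2 : 1 < (2 * (N : ℝ) - 1) * β) (ha : IsUniqueCode β N a) {n : ℕ}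
    (hn : -((N : ℤ) - 1) < a n) : -gap β N < β * tailValue β a (n + 1) := by
  have := ha.neg.lt_gap hN h0 h1 h2 (n := n) (by omega)
  rw [tailValue_neg] at this
  linarith

theorem mem_uniqueCodeSet_iff (hN : 2 ≤ N) (h0 : 0 < β) (h1 : N * β < 1) {t : ℝ} :
    t ∈ uniqueCodeSet β N ↔ ∃ a, IsUniqueCode β N a ∧ codeValue β N a = t := by
  have hβ := beta_lt_one hN h1
  have hs := scale_pos hN hβ
  have hN' : (2 : ℝ) ≤ N := by exact_mod_cast hN
  have key : ∀ a b, codeValue β N b = codeValue β N a ↔ tailValue β b 0 = tailValue β a 0 := by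
    intro a b
    rw [codeValue_eq, codeValue_eq]
    exact mul_right_inj' hs.ne'
  constructor
  · rintro ⟨-, a, ⟨ha, hat⟩, hu⟩
    refine ⟨a, ⟨ha, fun b hb hab => hu b ⟨hb, ?_⟩⟩, hat⟩
    rw [← hat, key, hab]
  · rintro ⟨a, ha, rfl⟩
    refine ⟨abs_le.1 ?_, a, ⟨ha.1, rfl⟩, fun b hb => ha.2 b hb.1 ((key _ _).1 hb.2)⟩
    rw [codeValue_eq, abs_mul, abs_of_pos hs]
    calc _ ≤ (1 - β) / ((N : ℝ) - 1) * (((N : ℝ) - 1) / (1 - β)) :=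
          mul_le_mul_of_nonneg_left (abs_tailValue_le h0 hβ ha.1 0) hs.le
      _ = 1 := by
          field_simp [show (N : ℝ) - 1 ≠ 0 by linarith, show 1 - β ≠ 0 by linarith]

end DigitSeries

/-! ### Self-similar sets and digit strings with bounded digits -/

/-- The set of values of digit strings `d` with `0 ≤ d l ≤ m l` for all `l`. -/
def boundedDigitSet (β : ℝ) (m : ℕ → ℤ) : Set ℝ :=
  {x | ∃ d : ℕ → ℤ, (∀ l, 0 ≤ d l ∧ d l ≤ m l) ∧ tailValue β d 0 = x}

section BoundedDigits

variable {β : ℝ} {N : ℕ} {a m : ℕ → ℤ}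

theorem IsGeneratedBy.isSelfSimilar {ι : Type*} [Finite ι] {r b : ι → ℝ} {G : Set ℝ}
    (hr : ∀ i, 0 < |r i| ∧ |r i| < 1) (h : IsGeneratedBy r b G) : IsSelfSimilar G := by
  obtain ⟨p, ⟨e⟩⟩ := Finite.exists_equiv_fin ι
  refine ⟨p, r ∘ e.symm, b ∘ e.symm, fun i => hr _, h.1, h.2.1, ?_⟩
  conv_lhs => rw [h.2.2]
  exact (e.symm.surjective.iUnion_comp fun i => (fun x => r i * x + b i) '' G).symm

theorem IsSelfSimilar.image_affine {G : Set ℝ} (h : IsSelfSimilar G) (u v : ℝ) :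
    IsSelfSimilar ((fun x => u * x + v) '' G) := by
  obtain ⟨p, r, b, hr, hne, hc, hG⟩ := h
  refine ⟨p, r, fun i => u * b i + v - r i * v, hr, hne.image _,
    hc.image (by fun_prop), ?_⟩
  conv_lhs => rw [hG]
  rw [Set.image_iUnion]
  refine Set.iUnion_congr fun i => ?_
  rw [Set.image_image, Set.image_image]
  refine Set.image_congr fun x _ => ?_
  ring

theorem isSelfSimilar_image_affine_iff {G : Set ℝ} {u : ℝ} (hu : u ≠ 0) (v : ℝ) :
    IsSelfSimilar ((fun x => u * x + v) '' G) ↔ IsSelfSimilar G := by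
  refine ⟨fun h => ?_, fun h => h.image_affine u v⟩
  have := h.image_affine u⁻¹ (-(u⁻¹ * v))
  rw [Set.image_image] at this
  have he : ∀ x, u⁻¹ * (u * x + v) + -(u⁻¹ * v) = x := by
    intro x
    field_simp
    ring
  simpa only [he, Set.image_id'] using this

/-- If `a` is the unique code of `t`, then a point of the Cantor set with digits `j` stays in the
Cantor set after translation by `-t` exactly when all digits `j l - a l` are admissible, which
leaves `N - |a l|` consecutive choices for each `j l`. -/
theorem inter_translate_eq (hN : 2 ≤ N) (h0 : 0 < β) (h1 : N * β < 1) (ha : IsUniqueCode β N a) :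
    cantorSet β N ∩ (fun x => x + codeValue β N a) '' cantorSet β N =
      (fun x => (1 - β) / ((N : ℝ) - 1) * x +
        (1 - β) / ((N : ℝ) - 1) * tailValue β (fun l => max (a l) 0) 0) ''
          boundedDigitSet β (fun l => (N : ℤ) - 1 - |a l|) := by
  have hβ := beta_lt_one hN h1
  have hs := (scale_pos hN hβ).ne'
  have hp : ∀ l, max (a l) 0 ∈ pmDigits N := by
    intro l
    obtain ⟨h3, h4⟩ := ha.1 l
    exact ⟨by omega, by omega⟩
  ext x
  constructor
  · rintro ⟨⟨j, hj, rfl⟩, _, ⟨k, hk, rfl⟩, hjk⟩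
    simp only [codeValue_eq, ← mul_add] at hjk
    have hjk := mul_left_cancel₀ hs hjk
    have hd : ∀ l, j l - k l ∈ pmDigits N := by
      intro l
      obtain ⟨h3, h4⟩ := hj l
      obtain ⟨h5, h6⟩ := hk l
      exact ⟨by omega, by omega⟩
    have hka : (fun l => j l - k l) = a := by
      refine ha.2 _ hd ?_
      have h3 := tailValue_add h0 hβ hd (fun l => digits_subset_pmDigits (hk l)) 0
      simp only [sub_add_cancel] at h3
      have h4 : tailValue β (fun l => j l) 0 = tailValue β j 0 := rfl
      linarith
    have hb : ∀ l, 0 ≤ j l - max (a l) 0 ∧ j l - max (a l) 0 ≤ (N : ℤ) - 1 - |a l| := by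
      intro l
      obtain ⟨h3, h4⟩ := hj l
      obtain ⟨h5, h6⟩ := hk l
      have h7 : j l - k l = a l := congrFun hka l
      rcases abs_cases (a l) with h8 | h8 <;> omega
    refine ⟨_, ⟨_, hb, rfl⟩, ?_⟩
    have hb' : ∀ l, j l - max (a l) 0 ∈ pmDigits N := by
      intro l
      obtain ⟨h3, h4⟩ := hb l
      have := abs_nonneg (a l)
      exact ⟨by omega, by omega⟩
    simp only
    rw [← mul_add, codeValue_eq, ← tailValue_add h0 hβ hb' hp]
    simp
  · rintro ⟨_, ⟨d, hd, rfl⟩, rfl⟩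
    replace hd : ∀ l, 0 ≤ d l ∧ d l ≤ (N : ℤ) - 1 - |a l| := hd
    have hd' : ∀ l, d l ∈ pmDigits N := by
      intro l
      obtain ⟨h3, h4⟩ := hd l
      have := abs_nonneg (a l)
      exact ⟨by omega, by omega⟩
    simp only
    rw [← mul_add, ← tailValue_add h0 hβ hd' hp]
    have hj : ∀ l, d l + max (a l) 0 ∈ digits N := by
      intro l
      obtain ⟨h3, h4⟩ := hd l
      rcases abs_cases (a l) with h8 | h8 <;> exact ⟨by omega, by omega⟩
    have hk : ∀ l, d l + max (a l) 0 - a l ∈ digits N := by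
      intro l
      obtain ⟨h3, h4⟩ := hd l
      rcases abs_cases (a l) with h8 | h8 <;> exact ⟨by omega, by omega⟩
    refine ⟨⟨_, hj, codeValue_eq _⟩, _, ⟨_, hk, rfl⟩, ?_⟩
    simp only
    rw [codeValue_eq, codeValue_eq, ← mul_add,
      ← tailValue_add h0 hβ (fun l => digits_subset_pmDigits (hk l)) ha.1]
    simp

theorem mem_selfSimilarSet_iff (hN : 2 ≤ N) (h0 : 0 < β) (h1 : N * β < 1) {t : ℝ} :
    t ∈ selfSimilarSet β N ↔ ∃ a, (IsUniqueCode β N a ∧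
      IsSelfSimilar (boundedDigitSet β fun l => (N : ℤ) - 1 - |a l|)) ∧ codeValue β N a = t := by
  have hs := (scale_pos hN (beta_lt_one hN h1)).ne'
  constructor
  · rintro ⟨ht, hss⟩
    obtain ⟨a, ha, rfl⟩ := (mem_uniqueCodeSet_iff hN h0 h1).1 ht
    rw [inter_translate_eq hN h0 h1 ha, isSelfSimilar_image_affine_iff hs] at hss
    exact ⟨a, ⟨ha, hss⟩, rfl⟩
  · rintro ⟨a, ⟨ha, hss⟩, rfl⟩
    refine ⟨(mem_uniqueCodeSet_iff hN h0 h1).2 ⟨a, ha, rfl⟩, ?_⟩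
    rwa [inter_translate_eq hN h0 h1 ha, isSelfSimilar_image_affine_iff hs]

theorem mem_digits_of_bounds (hm : ∀ l, m l ≤ (N : ℤ) - 1) {d : ℕ → ℤ}
    (hd : ∀ l, 0 ≤ d l ∧ d l ≤ m l) (l : ℕ) : d l ∈ digits N :=
  ⟨(hd l).1, (hd l).2.trans (hm l)⟩

theorem isCompact_boundedDigitSet (h0 : 0 < β) (h1 : β < 1) (hm : ∀ l, m l ≤ (N : ℤ) - 1) :
    IsCompact (boundedDigitSet β m) := by
  have hc : IsCompact (Set.univ.pi fun l : ℕ => Set.Icc 0 (m l)) :=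
    isCompact_univ_pi fun _ => (Set.finite_Icc _ _).isCompact
  have he : boundedDigitSet β m =
      (fun d => tailValue β d 0) '' (Set.univ.pi fun l : ℕ => Set.Icc 0 (m l)) := by
    ext x
    simp only [boundedDigitSet, Set.mem_image, Set.mem_pi, Set.mem_univ, true_imp_iff, Set.mem_Icc,
      Set.mem_ofPred_eq]
  rw [he]
  refine hc.image_of_continuousOn ?_
  unfold tailValue
  refine continuousOn_tsum (u := fun l => ((N : ℝ) - 1) * β ^ l) ?_
    ((summable_geometric_of_lt_one h0.le h1).mul_left _) ?_
  · intro l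
    have : Continuous fun j : ℕ → ℤ => (j (0 + l) : ℝ) :=
      continuous_of_discreteTopology.comp (continuous_apply _)
    exact (this.mul continuous_const).continuousOn
  · intro l d hd
    have hd' : d (0 + l) ∈ pmDigits N := digits_subset_pmDigits
      (mem_digits_of_bounds hm (fun l => hd l trivial) _)
    rw [norm_mul, Real.norm_eq_abs, norm_pow, Real.norm_of_nonneg h0.le]
    exact mul_le_mul_of_nonneg_right (abs_le_of_mem_pmDigits hd') (by positivity)

theorem tailValue_zero_eq_sum (h0 : 0 < β) (h1 : β < 1) (ha : ∀ l, a l ∈ pmDigits N) (K : ℕ) :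
    tailValue β a 0 = ∑ i ∈ Finset.range K, (a i : ℝ) * β ^ i + β ^ K * tailValue β a K := by
  induction K with
  | zero => simp
  | succ K ih =>
    rw [ih, Finset.sum_range_succ, tailValue_eq h0 h1 ha K, pow_succ]
    ring

/-- For periodic bounds the set is generated by the maps `x ↦ β ^ K * x + ∑ i < K, w i * β ^ i`,
one for each admissible word `w` whose length is the period `K`. -/
theorem isSelfSimilar_boundedDigitSet (h0 : 0 < β) (h1 : β < 1)
    (hm0 : ∀ l, 0 ≤ m l) (hm : ∀ l, m l ≤ (N : ℤ) - 1) {K : ℕ} (hK : 0 < K)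
    (hper : ∀ l, m (K + l) = m l) : IsSelfSimilar (boundedDigitSet β m) := by
  have hfin : Finite (Set.univ.pi fun i : Fin K => Set.Icc 0 (m i)) :=
    Set.Finite.to_subtype (Set.Finite.pi fun i => Set.finite_Icc _ _)
  have hpos := pow_pos h0 K
  refine IsGeneratedBy.isSelfSimilar
    (ι := Set.univ.pi fun i : Fin K => Set.Icc 0 (m i)) (r := fun _ => β ^ K)
    (b := fun w => ∑ i : Fin K, (w.1 i : ℝ) * β ^ (i : ℕ)) (fun _ => ?_)
    ⟨⟨_, fun _ => 0, fun l => ⟨le_rfl, hm0 l⟩, rfl⟩, isCompact_boundedDigitSet h0 h1 hm, ?_⟩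
  · rw [abs_of_pos hpos]
    exact ⟨hpos, pow_lt_one₀ h0.le h1 hK.ne'⟩
  ext x
  simp only [Set.mem_iUnion, Set.mem_image]
  have hpm : ∀ {d : ℕ → ℤ}, (∀ l, 0 ≤ d l ∧ d l ≤ m l) → ∀ l, d l ∈ pmDigits N :=
    fun hd l => digits_subset_pmDigits (mem_digits_of_bounds hm hd l)
  constructor
  · rintro ⟨d, hd, rfl⟩
    refine ⟨⟨fun i => d i, fun i _ => hd i⟩, tailValue β (fun l => d (K + l)) 0,
      ⟨_, fun l => ?_, rfl⟩, ?_⟩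
    · rw [← hper l]
      exact hd (K + l)
    · rw [tailValue_shift, add_zero, tailValue_zero_eq_sum h0 h1 (hpm hd) K, add_comm,
        Finset.sum_range]
  · rintro ⟨⟨w, hw⟩, _, ⟨d, hd, rfl⟩, rfl⟩
    set e : ℕ → ℤ := fun l => if h : l < K then w ⟨l, h⟩ else d (l - K) with he
    have hed : ∀ l, 0 ≤ e l ∧ e l ≤ m l := by
      intro l
      by_cases h : l < K
      · simp only [he, dif_pos h]
        exact hw ⟨l, h⟩ trivial
      · simp only [he, dif_neg h]
        have := hper (l - K)
        rw [show K + (l - K) = l by omega] at this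
        rw [this]
        exact hd _
    refine ⟨e, hed, ?_⟩
    rw [tailValue_zero_eq_sum h0 h1 (hpm hed) K, add_comm, Finset.sum_range]
    congr 1
    · congr 1
      unfold tailValue
      refine tsum_congr fun l => ?_
      simp [he]
    · refine Finset.sum_congr rfl fun i _ => ?_
      simp [he]

end BoundedDigits

/-! ### Positive Hausdorff dimension below the critical base -/

/-- A family of reals indexed by binary sequences has positive Hausdorff dimension if members
that part at place `q` are at least `c * ρ ^ q` apart: sending a member to the number in `[0, 1]`
with the same binary digits is then Hölder continuous, with exponent `log 2 / log (1 / ρ)`. -/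
theorem dimH_range_pos {g : (ℕ → Fin 2) → ℝ} {ρ c : ℝ} (hρ0 : 0 < ρ) (hρ1 : ρ < 1) (hc : 0 < c)
    (h : ∀ e e' q, (∀ i < q, e i = e' i) → e q ≠ e' q → c * ρ ^ q ≤ |g e - g e'|) :
    0 < dimH (Set.range g) := by
  have hdiff : ∀ e e' : ℕ → Fin 2, e ≠ e' → ∃ q, (∀ i < q, e i = e' i) ∧ e q ≠ e' q := by
    intro e e' hne
    have hex : ∃ q, e q ≠ e' q := by
      by_contra! hall
      exact hne (funext hall)
    exact ⟨Nat.find hex, fun i hi => not_not.1 (Nat.find_min hex hi), Nat.find_spec hex⟩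
  have hinj : Function.Injective g := by
    intro e e' hee
    by_contra hne
    obtain ⟨q, h1, h2⟩ := hdiff e e' hne
    have h3 := h e e' q h1 h2
    rw [hee, sub_self, abs_zero] at h3
    exact absurd h3 (not_le.2 (by positivity))
  set s : ℝ := Real.log (1 / 2) / Real.log ρ with hs
  have hs0 : 0 < s := div_pos_of_neg_of_neg (Real.log_neg (by norm_num) (by norm_num))
    (Real.log_neg hρ0 hρ1)
  have hρs : ρ ^ s = 1 / 2 := by
    rw [Real.rpow_def_of_pos hρ0, hs, mul_div_cancel₀ _ (Real.log_neg hρ0 hρ1).ne,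
      Real.exp_log (by norm_num)]
  set f : ℝ → ℝ := fun x => Real.ofDigits (Function.invFun g x) with hf
  have hfg : ∀ e, f (g e) = Real.ofDigits e := fun e => by
    rw [hf]; simp only; rw [Function.leftInverse_invFun hinj e]
  have hreal : ∀ e e', dist (f (g e)) (f (g e')) ≤ (c ^ s)⁻¹ * dist (g e) (g e') ^ s := by
    intro e e'
    rw [hfg, hfg, Real.dist_eq, Real.dist_eq]
    by_cases hne : e = e'
    · rw [hne]; simp only [sub_self, abs_zero]; positivity
    obtain ⟨q, h1, h2⟩ := hdiff e e' hne
    have h3 : ρ ^ q ≤ |g e - g e'| / c := by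
      rw [le_div_iff₀ hc, mul_comm]
      exact h e e' q h1 h2
    calc |Real.ofDigits e - Real.ofDigits e'| ≤ (((2 : ℕ) : ℝ) ^ q)⁻¹ :=
          Real.abs_ofDigits_sub_ofDigits_le h1
      _ = (ρ ^ q) ^ s := by
          rw [← Real.rpow_natCast ρ q, ← Real.rpow_mul hρ0.le, mul_comm, Real.rpow_mul hρ0.le, hρs,
            Real.rpow_natCast]
          simp
      _ ≤ (|g e - g e'| / c) ^ s := Real.rpow_le_rpow (by positivity) h3 hs0.le
      _ = (c ^ s)⁻¹ * |g e - g e'| ^ s := by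
          rw [Real.div_rpow (abs_nonneg _) hc.le, div_eq_inv_mul]
  have hC0 : 0 ≤ (c ^ s)⁻¹ := by positivity
  have hH : HolderOnWith (c ^ s)⁻¹.toNNReal s.toNNReal f (Set.range g) := by
    rintro _ ⟨e, rfl⟩ _ ⟨e', rfl⟩
    change _ ≤ ENNReal.ofReal (c ^ s)⁻¹ * _
    rw [edist_dist, edist_dist, Real.coe_toNNReal s hs0.le,
      ENNReal.ofReal_rpow_of_nonneg dist_nonneg hs0.le, ← ENNReal.ofReal_mul hC0]
    exact ENNReal.ofReal_le_ofReal (hreal e e')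
  have hdim := hH.dimH_image_le (Real.toNNReal_pos.2 hs0)
  have hsub : Set.Ico (0 : ℝ) 1 ⊆ f '' Set.range g := by
    intro x hx
    exact ⟨_, ⟨Real.digits x 2, rfl⟩, by rw [hfg, Real.ofDigits_digits (by norm_num) hx]⟩
  have hone : dimH (Set.Ico (0 : ℝ) 1) = 1 := by
    rw [Real.dimH_of_nonempty_interior (by simp)]
    simp
  have h1 := (dimH_mono hsub).trans hdim
  rw [hone] at h1
  by_contra h0
  rw [not_lt, nonpos_iff_eq_zero] at h0
  rw [h0, ENNReal.zero_div] at h1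
  exact absurd h1 (by simp)

section Spaced

variable {β : ℝ} {N : ℕ} {a : ℕ → ℤ}

/-- The critical base is where `gap β N = β`: both sides of the equivalence say
`β ^ 2 - (N + 1) * β + 1 > 0`. -/
theorem lt_alphaC_iff (hN : 2 ≤ N) (h0 : 0 < β) (h1 : N * β < 1) :
    β < alphaC N ↔ β < gap β N := by
  have hN' : (2 : ℝ) ≤ N := by exact_mod_cast hN
  have hβ := beta_lt_one hN h1
  have hD : 0 ≤ ((N : ℝ) - 1) * (N + 3) := mul_nonneg (by linarith) (by linarith)
  have e1 : β < alphaC N ↔ Real.sqrt (((N : ℝ) - 1) * (N + 3)) < N + 1 - 2 * β := by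
    unfold alphaC
    constructor <;> intro h <;> linarith
  rw [e1, Real.sqrt_lt hD (by linarith), gap, lt_div_iff₀ (by linarith)]
  constructor <;> intro h <;> nlinarith

theorem tailValue_of_zeros (h0 : 0 < β) (h1 : β < 1) (ha : ∀ l, a l ∈ pmDigits N) {n k : ℕ}
    (hz : ∀ i < k, a (n + i) = 0) : tailValue β a n = β ^ k * tailValue β a (n + k) := by
  induction k with
  | zero => simp
  | succ k ih =>
    rw [ih fun i hi => hz i (by omega), tailValue_eq h0 h1 ha (n + k), hz k (by omega), pow_succ,
      add_assoc]
    push_cast; ring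

/-- The digit string with entry `±1` at the multiples `K * q` of `K`, the sign being given by the
binary digit `e q`, and with all other entries `0`. -/
def spacedCode (K : ℕ) (e : ℕ → Fin 2) (l : ℕ) : ℤ :=
  if K ∣ l then 2 * (e (l / K) : ℤ) - 1 else 0

theorem abs_spacedCode (K : ℕ) (e : ℕ → Fin 2) (l : ℕ) :
    |spacedCode K e l| = if K ∣ l then 1 else 0 := by
  unfold spacedCode
  split_ifs
  · generalize e (l / K) = d
    fin_cases d <;> simp
  · simp

theorem spacedCode_mem (hN : 2 ≤ N) (K : ℕ) (e : ℕ → Fin 2) (l : ℕ) :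
    spacedCode K e l ∈ pmDigits N := by
  have := abs_spacedCode K e l
  refine abs_le.1 (this.trans_le ?_)
  split_ifs <;> omega

theorem isUniqueCode_spacedCode (hN : 2 ≤ N) (h0 : 0 < β) (h1 : N * β < 1) {k : ℕ}
    (hk : β * (1 + β ^ k) < gap β N) (e : ℕ → Fin 2) :
    IsUniqueCode β N (spacedCode (k + 1) e) := by
  have hβ := beta_lt_one hN h1
  have hg := gap_pos hN h1
  have ha := spacedCode_mem hN (k + 1) e
  have hle := abs_mul_tailValue_le hN h0 h1 ha
  have key : ∀ n, |β * tailValue β (spacedCode (k + 1) e) (n + 1)| < gap β N := by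
    intro n
    refine lt_of_le_of_lt ?_ hk
    rw [abs_mul, abs_of_pos h0, tailValue_eq h0 hβ ha]
    refine mul_le_mul_of_nonneg_left ?_ h0.le
    have habs := abs_spacedCode (k + 1) e (n + 1)
    by_cases hd : k + 1 ∣ n + 1
    · rw [if_pos hd] at habs
      have hz : ∀ i < k, spacedCode (k + 1) e (n + 1 + 1 + i) = 0 := by
        intro i hi
        rw [spacedCode, if_neg]
        intro hd'
        rw [add_assoc] at hd'
        have := Nat.le_of_dvd (by omega) ((Nat.dvd_add_right hd).1 hd')
        omega
      rw [tailValue_of_zeros h0 hβ ha hz]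
      refine (abs_add_le _ _).trans (add_le_add ?_ ?_)
      · exact_mod_cast habs.le
      · have h3 := hle (n + 1 + 1 + k)
        rw [mul_left_comm, abs_mul, abs_of_pos (pow_pos h0 k)]
        exact mul_le_of_le_one_right (pow_pos h0 k).le (by linarith)
    · rw [if_neg hd, abs_eq_zero] at habs
      rw [habs, Int.cast_zero, zero_add]
      have := pow_pos h0 k
      linarith [hle (n + 1 + 1)]
  exact isUniqueCode_of_lt_gap hN h0 h1 ha (fun n _ => (abs_lt.1 (key n)).2)
    (fun n _ => (abs_lt.1 (key n)).1)

theorem codeValue_spacedCode_mem (hN : 2 ≤ N) (h0 : 0 < β) (h1 : N * β < 1) {k : ℕ}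
    (hk : β * (1 + β ^ k) < gap β N) (e : ℕ → Fin 2) :
    codeValue β N (spacedCode (k + 1) e) ∈ selfSimilarSet β N := by
  refine (mem_selfSimilarSet_iff hN h0 h1).2
    ⟨_, ⟨isUniqueCode_spacedCode hN h0 h1 hk e, ?_⟩, rfl⟩
  refine isSelfSimilar_boundedDigitSet (N := N) (K := k + 1) h0 (beta_lt_one hN h1) ?_ ?_
    (by omega) ?_
  · intro l
    rw [abs_spacedCode]
    split_ifs <;> omega
  · intro l
    have := abs_nonneg (spacedCode (k + 1) e l)
    omega
  · intro l
    simp only [abs_spacedCode, Nat.dvd_add_right (dvd_refl (k + 1))]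

theorem spacedCode_separated (hN : 2 ≤ N) (h0 : 0 < β) (h1 : N * β < 1) {k : ℕ}
    {e e' : ℕ → Fin 2} {q : ℕ} (hlt : ∀ i < q, e i = e' i) (hq : e q ≠ e' q) :
    2 * gap β N * β ^ ((k + 1) * q) ≤
      |tailValue β (spacedCode (k + 1) e) 0 - tailValue β (spacedCode (k + 1) e') 0| := by
  have hβ := beta_lt_one hN h1
  have ha := spacedCode_mem hN (k + 1) e
  have ha' := spacedCode_mem hN (k + 1) e'
  have hval : ∀ d : ℕ → Fin 2, spacedCode (k + 1) d ((k + 1) * q) = 2 * (d q : ℤ) - 1 := by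
    intro d
    rw [spacedCode, if_pos (dvd_mul_right _ _), Nat.mul_div_cancel_left _ (by omega)]
  have hsum : ∑ i ∈ Finset.range ((k + 1) * q), (spacedCode (k + 1) e i : ℝ) * β ^ i =
      ∑ i ∈ Finset.range ((k + 1) * q), (spacedCode (k + 1) e' i : ℝ) * β ^ i := by
    refine Finset.sum_congr rfl fun i hi => ?_
    have hi' : i / (k + 1) < q := Nat.div_lt_of_lt_mul (Finset.mem_range.1 hi)
    rw [spacedCode, spacedCode, hlt _ hi']
  rw [tailValue_zero_eq_sum h0 hβ ha ((k + 1) * q), tailValue_zero_eq_sum h0 hβ ha' ((k + 1) * q),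
    hsum, add_sub_add_left_eq_sub, ← mul_sub, abs_mul, abs_of_pos (pow_pos h0 _), mul_comm]
  refine mul_le_mul_of_nonneg_left ?_ (pow_pos h0 _).le
  rw [tailValue_eq h0 hβ ha, tailValue_eq h0 hβ ha', hval, hval]
  have h3 := abs_le.1 (abs_mul_tailValue_le hN h0 h1 ha ((k + 1) * q + 1))
  have h4 := abs_le.1 (abs_mul_tailValue_le hN h0 h1 ha' ((k + 1) * q + 1))
  generalize e q = d at *
  generalize e' q = d' at *
  rw [le_abs]
  fin_cases d <;> fin_cases d' <;> simp at hq ⊢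
  · right; linarith
  · left; linarith

theorem dimH_selfSimilarSet_pos (hN : 2 ≤ N) (h0 : 0 < β) (h1 : N * β < 1)
    (hlt : β < alphaC N) : 0 < dimH (selfSimilarSet β N) := by
  have hβ := beta_lt_one hN h1
  have hg := (lt_alphaC_iff hN h0 h1).1 hlt
  obtain ⟨k, hk⟩ := exists_pow_lt_of_lt_one (div_pos (sub_pos.2 hg) h0) hβ
  have hk' : β * (1 + β ^ k) < gap β N := by
    rw [lt_div_iff₀ h0] at hk
    linarith
  have hs := scale_pos hN hβ
  refine lt_of_lt_of_le (dimH_range_pos (g := fun e => codeValue β N (spacedCode (k + 1) e))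
    (ρ := β ^ (k + 1)) (c := (1 - β) / ((N : ℝ) - 1) * (2 * gap β N)) (pow_pos h0 _)
    (pow_lt_one₀ h0.le hβ (by omega)) (mul_pos hs (by linarith)) ?_) (dimH_mono ?_)
  · intro e e' q h3 h4
    rw [codeValue_eq, codeValue_eq, ← mul_sub, abs_mul, abs_of_pos hs, mul_assoc, ← pow_mul]
    exact mul_le_mul_of_nonneg_left (spacedCode_separated hN h0 h1 h3 h4) hs.le
  · rintro _ ⟨e, rfl⟩
    exact codeValue_spacedCode_mem hN h0 h1 hk' e

end Spaced

/-! ### Infinitely many self-similar intersections -/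

section Infinite

variable {β : ℝ} {N : ℕ}

/-- The digit string `N - 1, …, N - 1, 0, 0, …` with `n` nonzero entries. -/
def blockCode (N n : ℕ) (l : ℕ) : ℤ := if l < n then (N : ℤ) - 1 else 0

theorem isUniqueCode_blockCode (hN : 2 ≤ N) (h0 : 0 < β) (h1 : N * β < 1) (n : ℕ) :
    IsUniqueCode β N (blockCode N n) := by
  have hg := gap_pos hN h1
  have hnn : ∀ l, 0 ≤ blockCode N n l := by
    intro l
    unfold blockCode
    split_ifs <;> omega
  refine isUniqueCode_of_lt_gap hN h0 h1 ?_ ?_ ?_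
  · intro l
    refine ⟨by have := hnn l; omega, ?_⟩
    unfold blockCode
    split_ifs <;> omega
  · intro l hl
    have hl' : ¬ l < n := by
      intro h
      simp [blockCode, h] at hl
    have : tailValue β (blockCode N n) (l + 1) = 0 := by
      unfold tailValue blockCode
      simp [show ∀ i, ¬ l + 1 + i < n by omega]
    rw [this, mul_zero]
    exact hg
  · intro l _
    have := mul_nonneg h0.le (tailValue_nonneg h0 hnn (l + 1))
    linarith

theorem boundedDigitSet_blockCode (hN : 2 ≤ N) (h0 : 0 < β) (h1 : β < 1) (n : ℕ) :
    boundedDigitSet β (fun l => (N : ℤ) - 1 - |blockCode N n l|) =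
      (fun x => β ^ n * x + 0) '' boundedDigitSet β (fun _ => (N : ℤ) - 1) := by
  have hbd : ∀ l, (N : ℤ) - 1 - |blockCode N n l| = if l < n then 0 else (N : ℤ) - 1 := by
    intro l
    unfold blockCode
    split_ifs
    · rw [abs_of_nonneg (by omega), sub_self]
    · simp
  have hle : ∀ l, (N : ℤ) - 1 - |blockCode N n l| ≤ (N : ℤ) - 1 := by
    intro l
    have := abs_nonneg (blockCode N n l)
    omega
  have hz : ∀ d : ℕ → ℤ, (∀ l, 0 ≤ d l ∧ d l ≤ (N : ℤ) - 1 - |blockCode N n l|) →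
      tailValue β d 0 = β ^ n * tailValue β d n := by
    intro d hd
    have := tailValue_of_zeros h0 h1
      (fun l => digits_subset_pmDigits (mem_digits_of_bounds hle hd l)) (n := 0) (k := n) (by
        intro i hi
        have := hd (0 + i)
        rw [hbd, if_pos (by omega)] at this
        omega)
    rwa [zero_add] at this
  ext x
  constructor
  · rintro ⟨d, hd, rfl⟩
    refine ⟨tailValue β (fun l => d (n + l)) 0,
      ⟨_, fun l => ⟨(hd _).1, (hd _).2.trans (hle _)⟩, rfl⟩, ?_⟩
    simp only
    rw [tailValue_shift, add_zero, add_zero, hz d hd]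
  · rintro ⟨_, ⟨d, hd, rfl⟩, rfl⟩
    have he : ∀ l, 0 ≤ (if l < n then 0 else d (l - n)) ∧
        (if l < n then 0 else d (l - n)) ≤ (N : ℤ) - 1 - |blockCode N n l| := by
      intro l
      rw [hbd]
      split_ifs
      · exact ⟨le_rfl, le_rfl⟩
      · exact hd _
    refine ⟨_, he, ?_⟩
    rw [hz _ he]
    simp only [add_zero]
    congr 1
    simp [tailValue]

/-- The translations by the numbers with codes `blockCode N n` cut out scaled copies of the Cantor
set. -/
theorem selfSimilarSet_infinite (hN : 2 ≤ N) (h0 : 0 < β) (h1 : N * β < 1) :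
    (selfSimilarSet β N).Infinite := by
  have hβ := beta_lt_one hN h1
  refine Set.infinite_of_injective_forall_mem (f := fun n => codeValue β N (blockCode N n)) ?_ ?_
  · intro n n' h
    simp only [codeValue_eq] at h
    have h := mul_left_cancel₀ (scale_pos hN hβ).ne' h
    have h := (isUniqueCode_blockCode hN h0 h1 n').2 _ (isUniqueCode_blockCode hN h0 h1 n).1 h
    by_contra hne
    rcases Nat.lt_or_gt_of_ne hne with hlt | hlt
    · have := congrFun h n
      simp only [blockCode, lt_irrefl, if_false, if_pos hlt] at this
      omega
    · have := congrFun h n'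
      simp only [blockCode, lt_irrefl, if_false, if_pos hlt] at this
      omega
  · intro n
    refine (mem_selfSimilarSet_iff hN h0 h1).2 ⟨_, ⟨isUniqueCode_blockCode hN h0 h1 n, ?_⟩, rfl⟩
    rw [boundedDigitSet_blockCode hN h0 hβ]
    exact (isSelfSimilar_boundedDigitSet (N := N) (K := 1) h0 hβ (fun _ => by omega)
      (fun _ => le_rfl) one_pos fun _ => rfl).image_affine _ _

end Infinite

/-! ### Self-similarity forces eventual periodicity -/

section Periodicity

variable {β : ℝ} {N : ℕ} {a m : ℕ → ℤ}

/-- A self-similar set of this form is mapped into itself by some `x ↦ r * x` with `0 < r < 1`: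
the generating map that hits the least element `0` either fixes `0` or, if it reverses the
orientation, does so after composition with the reflection `x ↦ max - x`, which preserves the
set. -/
theorem exists_mul_mem_of_isSelfSimilar (h0 : 0 < β) (h1 : β < 1)
    (hm0 : ∀ l, 0 ≤ m l) (hm : ∀ l, m l ≤ (N : ℤ) - 1) (h : IsSelfSimilar (boundedDigitSet β m)) :
    ∃ r : ℝ, 0 < r ∧ r < 1 ∧ ∀ x ∈ boundedDigitSet β m, r * x ∈ boundedDigitSet β m := by
  obtain ⟨p, r, b, hr, -, -, hE⟩ := h
  set E := boundedDigitSet β m with hEdef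
  set S := tailValue β m 0 with hS
  have hnn : ∀ x ∈ E, 0 ≤ x := by
    rintro _ ⟨d, hd, rfl⟩
    exact tailValue_nonneg h0 (fun l => (hd l).1) 0
  have hzero : (0 : ℝ) ∈ E := ⟨fun _ => 0, fun l => ⟨le_rfl, hm0 l⟩, by simp [tailValue]⟩
  have hrefl : ∀ x ∈ E, S - x ∈ E := by
    rintro _ ⟨d, hd, rfl⟩
    refine ⟨fun l => m l - d l, fun l => ⟨sub_nonneg.2 (hd l).2, sub_le_self _ (hd l).1⟩, ?_⟩
    have h2 := tailValue_add h0 h1 (N := N) (a := fun l => m l - d l) (b := d) (M := N)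
      (fun l => digits_subset_pmDigits
        ⟨sub_nonneg.2 (hd l).2, (sub_le_self _ (hd l).1).trans (hm l)⟩)
      (fun l => digits_subset_pmDigits (mem_digits_of_bounds hm hd l)) 0
    simp only [sub_add_cancel] at h2
    have h3 : tailValue β (fun l => m l) 0 = S := rfl
    linarith
  have hmap : ∀ i, ∀ x ∈ E, r i * x + b i ∈ E := by
    intro i x hx
    rw [hE]
    exact Set.mem_iUnion.2 ⟨i, x, hx, rfl⟩
  have hz := hzero
  rw [hE] at hz
  obtain ⟨i, y, hy, hyz⟩ := Set.mem_iUnion.1 hz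
  simp only at hyz
  refine ⟨|r i|, (hr i).1, (hr i).2, fun x hx => ?_⟩
  rcases le_or_gt 0 (r i) with hpos | hneg
  · have h2 := hnn _ (hmap i 0 hzero)
    have h3 := mul_nonneg hpos (hnn y hy)
    have h4 : b i = 0 := by linarith
    have h5 := hmap i x hx
    rwa [h4, add_zero, ← abs_of_nonneg hpos] at h5
  · have h2 := hnn _ (hmap i S (by simpa using hrefl 0 hzero))
    have h3 := hnn _ (hrefl y hy)
    have h4 : b i = -(r i * S) := by nlinarith
    have h5 := hmap i _ (hrefl x hx)
    rw [h4] at h5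
    rw [abs_of_neg hneg]
    convert h5 using 1
    ring

/-- If no multiple of `θ` has its fractional part in `(0, δ)`, then `θ` is rational. -/
theorem exists_nat_mul_eq_of_gaps {θ δ : ℝ} (hθ : 0 < θ) (hδ : 0 < δ)
    (h : ∀ k : ℕ, ∃ z : ℤ, z + δ ≤ k * θ ∧ k * θ ≤ z + 1) :
    ∃ q p : ℕ, 0 < q ∧ 0 < p ∧ q * θ = p := by
  obtain ⟨n, hn⟩ := exists_nat_one_div_lt hδ
  obtain ⟨j, k, hk0, -, hjk⟩ := Real.exists_int_int_abs_mul_sub_le θ (n := n + 1) n.succ_pos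
  lift k to ℕ using hk0.le
  have hk0' : 0 < k := by exact_mod_cast hk0
  push_cast at hjk
  have hsmall : |k * θ - j| < δ := by
    refine lt_of_le_of_lt (hjk.trans ?_) hn
    exact one_div_le_one_div_of_le (by positivity) (by linarith)
  have hk' : (0 : ℝ) < k := by exact_mod_cast hk0'
  rcases lt_trichotomy (k * θ) j with hlt | heq | hgt
  · -- The multiple falls short of `j` by `η < δ`, so some further multiple exceeds an integer by
    -- less than `δ`.
    exfalso
    set η := j - k * θ with hη
    have hη0 : 0 < η := by linarith
    have hηδ : η < δ := by
      rw [abs_sub_comm, abs_of_pos hη0] at hsmall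
      exact hsmall
    have hceil : 0 < ⌈1 / η⌉₊ := Nat.ceil_pos.2 (by positivity)
    obtain ⟨c, hc⟩ := Nat.exists_eq_succ_of_ne_zero hceil.ne'
    have hc1 : (c : ℝ) < 1 / η := Nat.lt_ceil.1 (by omega)
    have hc2 : 1 / η ≤ c + 1 := by
      have := Nat.le_ceil (1 / η)
      rw [hc] at this
      exact_mod_cast this
    rw [lt_div_iff₀ hη0] at hc1
    rw [div_le_iff₀ hη0] at hc2
    obtain ⟨z, hz1, hz2⟩ := h (c * k)
    push_cast at hz1 hz2
    have e : (c : ℝ) * k * θ = c * j - c * η := by rw [hη]; ring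
    rw [e] at hz1 hz2
    have h3 : ((c * j : ℤ) : ℝ) < ((z + 2 : ℤ) : ℝ) := by push_cast; linarith
    have h4 : (c : ℤ) * j ≤ z + 1 := by
      have := Int.cast_lt.1 h3
      omega
    have h5 : (c : ℝ) * j ≤ z + 1 := by exact_mod_cast h4
    linarith
  · have hj : 0 < j := by
      have : (0 : ℝ) < j := heq ▸ mul_pos hk' hθ
      exact_mod_cast this
    lift j to ℕ using hj.le
    exact ⟨k, j, hk0', by exact_mod_cast hj, by exact_mod_cast heq⟩
  · exfalso
    rw [abs_of_pos (by linarith)] at hsmall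
    obtain ⟨z, hz1, hz2⟩ := h k
    have h3 : (z : ℝ) < j := by linarith
    have h4 : z + 1 ≤ j := by
      have := Int.cast_lt.1 h3
      omega
    have h5 : (z : ℝ) + 1 ≤ j := by exact_mod_cast h4
    linarith

/-- The leading digit confines the value of a digit string to the intervals
`[β ^ j, (1 - gap β N) * β ^ (j - 1)]`, which leave gaps at all scales. -/
theorem exists_pow_le_tailValue (hN : 2 ≤ N) (h0 : 0 < β) (h1 : N * β < 1)
    {d : ℕ → ℤ} (hd : ∀ l, d l ∈ digits N) (hpos : 0 < tailValue β d 0) :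
    ∃ j : ℕ, β ^ j ≤ tailValue β d 0 ∧ β * tailValue β d 0 ≤ (1 - gap β N) * β ^ j := by
  have hβ := beta_lt_one hN h1
  have hd' := fun l => digits_subset_pmDigits (hd l)
  have hex : ∃ n, d n ≠ 0 := by
    by_contra! hall
    simp [tailValue, hall] at hpos
  classical
  have hn := Nat.find_spec hex
  have hz : ∀ i < Nat.find hex, d (0 + i) = 0 := fun i hi => by
    rw [zero_add]
    exact not_not.1 (Nat.find_min hex hi)
  refine ⟨Nat.find hex, ?_⟩
  generalize Nat.find hex = n at *
  have hp := pow_pos h0 n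
  rw [tailValue_of_zeros h0 hβ hd' hz, zero_add]
  constructor
  · refine le_mul_of_one_le_right hp.le ?_
    rw [tailValue_eq h0 hβ hd']
    have h3 := mul_nonneg h0.le (tailValue_nonneg h0 (fun l => (hd l).1) (n + 1))
    have h4 : 1 ≤ d n := by
      have := (hd n).1
      omega
    have h5 : (1 : ℝ) ≤ d n := by exact_mod_cast h4
    linarith
  · have := (abs_le.1 (abs_mul_tailValue_le hN h0 h1 hd' n)).2
    nlinarith

theorem tailValue_single (n : ℕ) (c : ℤ) :
    tailValue β (Pi.single n c) 0 = c * β ^ n := by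
  unfold tailValue
  rw [tsum_eq_single n fun l hl => by simp [hl]]
  simp

theorem mul_pow_mem_boundedDigitSet (hm0 : ∀ l, 0 ≤ m l) {l : ℕ} {c : ℤ} (hc0 : 0 ≤ c)
    (hc : c ≤ m l) : c * β ^ l ∈ boundedDigitSet β m := by
  refine ⟨Pi.single l c, fun i => ?_, tailValue_single l c⟩
  by_cases hi : i = l
  · subst hi
    simpa using ⟨hc0, hc⟩
  · simpa [Pi.single_apply, hi] using hm0 i

/-- If `x ↦ r * x` maps the set into itself, so do its iterates. The numbers `r ^ k * β ^ l` then
avoid the gaps at all scales, which forces a power of `r` to be a power of `β`. -/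
theorem exists_pow_mul_mem (hN : 2 ≤ N) (h0 : 0 < β) (h1 : N * β < 1)
    (hm0 : ∀ l, 0 ≤ m l) (hm : ∀ l, m l ≤ (N : ℤ) - 1) {l : ℕ} (hl : 1 ≤ m l)
    {r : ℝ} (hr0 : 0 < r) (hr1 : r < 1)
    (hr : ∀ x ∈ boundedDigitSet β m, r * x ∈ boundedDigitSet β m) :
    ∃ p : ℕ, 0 < p ∧ ∀ x ∈ boundedDigitSet β m, β ^ p * x ∈ boundedDigitSet β m := by
  have hβ := beta_lt_one hN h1
  have hg := gap_pos hN h1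
  have hg1 := gap_lt_one hN h0 h1
  have hlogβ := Real.log_neg h0 hβ
  have hlogr := Real.log_neg hr0 hr1
  have hlogg := Real.log_neg (x := 1 - gap β N) (by linarith) (by linarith)
  have hiter : ∀ k : ℕ, ∀ x ∈ boundedDigitSet β m, r ^ k * x ∈ boundedDigitSet β m := by
    intro k
    induction k with
    | zero => simp
    | succ k ih =>
      intro x hx
      rw [pow_succ, mul_assoc]
      exact ih _ (hr x hx)
  obtain ⟨q, p, hq, hp, hqp⟩ := exists_nat_mul_eq_of_gaps
    (θ := Real.log r / Real.log β) (δ := Real.log (1 - gap β N) / Real.log β)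
    (div_pos_of_neg_of_neg hlogr hlogβ) (div_pos_of_neg_of_neg hlogg hlogβ) (by
      intro k
      have hmem := mul_pow_mem_boundedDigitSet (β := β) hm0 zero_le_one hl
      rw [Int.cast_one, one_mul] at hmem
      obtain ⟨d, hd, hdx⟩ := hiter k _ hmem
      have hx : 0 < r ^ k * β ^ l := by positivity
      obtain ⟨j, hj1, hj2⟩ := exists_pow_le_tailValue hN h0 h1 (mem_digits_of_bounds hm hd)
        (hdx ▸ hx)
      rw [hdx] at hj1 hj2
      have hlog : Real.log (r ^ k * β ^ l) = k * Real.log r + l * Real.log β := by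
        rw [Real.log_mul (by positivity) (by positivity), Real.log_pow, Real.log_pow]
      have h3 := Real.log_le_log (pow_pos h0 j) hj1
      have h4 := Real.log_le_log (by positivity) hj2
      rw [Real.log_mul h0.ne' hx.ne', hlog, Real.log_mul (by linarith) (by positivity),
        Real.log_pow] at h4
      rw [hlog, Real.log_pow] at h3
      have hne := hlogβ.ne
      refine ⟨(j : ℤ) - 1 - l, ?_, ?_⟩
      · push_cast
        rw [← mul_div_assoc, ← sub_nonneg]
        have : (k : ℝ) * Real.log r / Real.log β -
            ((j : ℝ) - 1 - l + Real.log (1 - gap β N) / Real.log β) =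
          (k * Real.log r - (j - 1 - l) * Real.log β - Real.log (1 - gap β N)) / Real.log β := by
          field_simp
          ring
        rw [this]
        exact div_nonneg_of_nonpos (by linarith) hlogβ.le
      · push_cast
        rw [← mul_div_assoc, div_le_iff_of_neg hlogβ]
        linarith)
  refine ⟨p, hp, fun x hx => ?_⟩
  have hpow : r ^ q = β ^ p := by
    rw [← mul_div_assoc, div_eq_iff hlogβ.ne, ← Real.log_pow, ← Real.log_pow] at hqp
    exact Real.log_injOn_pos (Set.mem_Ioi.2 (by positivity)) (Set.mem_Ioi.2 (by positivity)) hqp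
  rw [← hpow]
  exact hiter q x hx

theorem le_of_pow_mul_mem (hN : 2 ≤ N) (h0 : 0 < β) (h1 : N * β < 1)
    (hm0 : ∀ l, 0 ≤ m l) (hm : ∀ l, m l ≤ (N : ℤ) - 1) {p : ℕ}
    (hp : ∀ x ∈ boundedDigitSet β m, β ^ p * x ∈ boundedDigitSet β m) (l : ℕ) :
    m l ≤ m (l + p) := by
  obtain ⟨d, hd, hdx⟩ := hp _ (mul_pow_mem_boundedDigitSet hm0 (hm0 l) le_rfl)
  have hsingle : ∀ i, (Pi.single (l + p) (m l) : ℕ → ℤ) i ∈ digits N := by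
    intro i
    by_cases hi : i = l + p
    · subst hi
      simpa using ⟨hm0 l, hm l⟩
    · simp only [Pi.single_apply, hi, if_false]
      exact ⟨le_rfl, by omega⟩
  have he := digits_ext hN h0 h1 (mem_digits_of_bounds hm hd) hsingle (by
    rw [hdx, tailValue_single, pow_add]; ring)
  have := (hd (l + p)).2
  rw [he] at this
  simpa using this

theorem exists_eventually_periodic {u : ℕ → ℕ} {p : ℕ} (hu : ∀ l, u (l + p) ≤ u l) :
    ∃ L, ∀ l ≥ L, u (l + p) = u l := by
  set S : ℕ → ℕ := fun l => ∑ i ∈ Finset.range p, u (l + i) with hS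
  have hstep : ∀ l, S (l + 1) + u l = S l + u (l + p) := by
    intro l
    have h3 := Finset.sum_range_succ (fun i => u (l + i)) p
    have h4 := Finset.sum_range_succ' (fun i => u (l + i)) p
    simp only [hS]
    rw [← h3, h4, add_zero]
    congr 1
    exact Finset.sum_congr rfl fun i _ => congrArg u (by ring)
  have hanti : Antitone S := antitone_nat_of_succ_le fun l => by
    have := hstep l
    have := hu l
    omega
  obtain ⟨L, hL⟩ : ∃ L, ∀ l, S L ≤ S l :=
    ⟨Function.argmin S, fun l => Function.argmin_le S l⟩
  refine ⟨L, fun l hl => ?_⟩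
  have h3 := hanti hl
  have h4 := hL (l + 1)
  have h5 := hstep l
  have h6 := hu l
  omega

/-- The sequences of natural numbers that are periodic from some place on. -/
def eventuallyPeriodic : Set (ℕ → ℕ) := {u | ∃ p L : ℕ, 0 < p ∧ ∀ l ≥ L, u (l + p) = u l}

theorem countable_eventuallyPeriodic : eventuallyPeriodic.Countable := by
  have he : eventuallyPeriodic =
      ⋃ p : ℕ, ⋃ L : ℕ, {u | 0 < p ∧ ∀ l ≥ L, u (l + p) = u l} := by
    ext u
    simp [eventuallyPeriodic]
  rw [he]
  refine Set.countable_iUnion fun p => Set.countable_iUnion fun L => ?_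
  refine Set.MapsTo.countable_of_injOn (f := fun u (i : Fin (L + p)) => u i)
    (t := Set.univ) (fun _ _ => trivial) ?_ Set.countable_univ
  rintro u ⟨hp, hu⟩ v ⟨-, hv⟩ huv
  funext l
  induction l using Nat.strong_induction_on with
  | _ l ih =>
    by_cases hl : l < L + p
    · exact congrFun huv ⟨l, hl⟩
    · have h3 := hu (l - p) (by omega)
      have h4 := hv (l - p) (by omega)
      rw [show l - p + p = l by omega] at h3 h4
      rw [h3, h4]
      exact ih _ (by omega)

theorem natAbs_mem_eventuallyPeriodic (hN : 2 ≤ N) (h0 : 0 < β) (h1 : N * β < 1)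
    (ha : ∀ l, a l ∈ pmDigits N)
    (hss : IsSelfSimilar (boundedDigitSet β fun l => (N : ℤ) - 1 - |a l|)) :
    (fun l => (a l).natAbs) ∈ eventuallyPeriodic := by
  have habs : ∀ l, |a l| ≤ (N : ℤ) - 1 := fun l => abs_le.2 (ha l)
  by_cases hex : ∃ l, 1 ≤ (N : ℤ) - 1 - |a l|
  · obtain ⟨l, hl⟩ := hex
    have hm0 : ∀ l, 0 ≤ (N : ℤ) - 1 - |a l| := fun l => sub_nonneg.2 (habs l)
    have hm : ∀ l, (N : ℤ) - 1 - |a l| ≤ (N : ℤ) - 1 := fun l => sub_le_self _ (abs_nonneg _)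
    obtain ⟨r, hr0, hr1, hr⟩ :=
      exists_mul_mem_of_isSelfSimilar h0 (beta_lt_one hN h1) hm0 hm hss
    obtain ⟨p, hp, hpm⟩ := exists_pow_mul_mem hN h0 h1 hm0 hm hl hr0 hr1 hr
    obtain ⟨L, hL⟩ := exists_eventually_periodic (u := fun l => (a l).natAbs) (p := p) (by
      intro l
      have := le_of_pow_mul_mem hN h0 h1 hm0 hm hpm l
      rw [Int.abs_eq_natAbs, Int.abs_eq_natAbs] at this
      omega)
    exact ⟨p, L, hp, hL⟩
  · push Not at hex
    refine ⟨1, 0, one_pos, fun l _ => ?_⟩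
    have h3 := habs l
    have h4 := habs (l + 1)
    have h5 := hex l
    have h6 := hex (l + 1)
    rw [Int.abs_eq_natAbs] at h3 h4 h5 h6
    show (a (l + 1)).natAbs = (a l).natAbs
    omega

end Periodicity

/-! ### Signs of a unique code above the critical base -/

section Signs

variable {β : ℝ} {N : ℕ} {a b : ℕ → ℤ}

/-- From a place with a short tail on, and for `gap β N ≤ β`, a nonzero digit has the sign of the
tail that it starts, and the next tail is short again. -/
theorem IsUniqueCode.short_tail_step (hN : 2 ≤ N) (h0 : 0 < β) (h1 : N * β < 1)
    (h2 : 1 < (2 * (N : ℝ) - 1) * β) (hgβ : gap β N ≤ β) (ha : IsUniqueCode β N a) {n : ℕ}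
    (hn : |β * tailValue β a n| < gap β N) :
    |β * tailValue β a (n + 1)| < gap β N ∧
      (0 < a n → 0 < tailValue β a n ∧ tailValue β a (n + 1) < 0) ∧
      (a n < 0 → tailValue β a n < 0 ∧ 0 < tailValue β a (n + 1)) := by
  have hβ := beta_lt_one hN h1
  have hg := gap_pos hN h1
  have htail := abs_le.1 (abs_mul_tailValue_le hN h0 h1 ha.1 (n + 1))
  have hV : |tailValue β a n| < 1 := by
    rw [abs_mul, abs_of_pos h0] at hn
    by_contra! hge
    nlinarith
  have hV := abs_lt.1 hV
  have heq := tailValue_eq h0 hβ ha.1 n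
  rcases lt_trichotomy (a n) 0 with hneg | hz | hpos
  · have h3 : (a n : ℝ) ≤ -1 := by exact_mod_cast Int.le_sub_one_of_lt hneg
    have h4 : 0 < β * tailValue β a (n + 1) := by linarith
    have h5 := ha.lt_gap hN h0 h1 h2 (n := n) (by omega)
    exact ⟨abs_lt.2 ⟨by linarith, h5⟩, fun h => absurd h (by omega),
      fun _ => ⟨by linarith, pos_of_mul_pos_right h4 h0.le⟩⟩
  · have h5 := ha.lt_gap hN h0 h1 h2 (n := n) (by omega)
    have h6 := ha.neg_gap_lt hN h0 h1 h2 (n := n) (by omega)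
    exact ⟨abs_lt.2 ⟨h6, h5⟩, fun h => absurd h (by omega), fun h => absurd h (by omega)⟩
  · have h3 : (1 : ℝ) ≤ a n := by exact_mod_cast hpos
    have h4 : β * tailValue β a (n + 1) < 0 := by linarith
    have h5 := ha.neg_gap_lt hN h0 h1 h2 (n := n) (by omega)
    exact ⟨abs_lt.2 ⟨h5, by linarith⟩,
      fun _ => ⟨by linarith, by
        by_contra! h
        exact absurd (mul_nonneg h0.le h) (not_le.2 h4)⟩, fun h => absurd h (by omega)⟩

/-- From a short tail on, the absolute values of the digits and the sign of that tail determine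
all digits. -/
theorem IsUniqueCode.eq_of_natAbs_eq (hN : 2 ≤ N) (h0 : 0 < β) (h1 : N * β < 1)
    (h2 : 1 < (2 * (N : ℝ) - 1) * β) (hgβ : gap β N ≤ β)
    (ha : IsUniqueCode β N a) (hb : IsUniqueCode β N b) {n : ℕ}
    (han : |β * tailValue β a n| < gap β N) (hbn : |β * tailValue β b n| < gap β N)
    (hsign : SignType.sign (tailValue β a n) = SignType.sign (tailValue β b n))
    (habs : ∀ l, (a l).natAbs = (b l).natAbs) {l : ℕ} (hl : n ≤ l) : a l = b l := by
  have hβ := beta_lt_one hN h1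
  have digit : ∀ k, |β * tailValue β a k| < gap β N → |β * tailValue β b k| < gap β N →
      SignType.sign (tailValue β a k) = SignType.sign (tailValue β b k) → a k = b k := by
    intro k hak hbk hs
    obtain ⟨-, ha1, ha2⟩ := ha.short_tail_step hN h0 h1 h2 hgβ hak
    obtain ⟨-, hb1, hb2⟩ := hb.short_tail_step hN h0 h1 h2 hgβ hbk
    have h3 := habs k
    rcases Int.natAbs_eq_natAbs_iff.1 h3 with h4 | h4
    · exact h4
    rcases lt_trichotomy (b k) 0 with h5 | h5 | h5
    · rw [sign_pos (ha1 (by omega)).1, sign_neg (hb2 h5).1] at hs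
      exact absurd hs (by decide)
    · omega
    · rw [sign_neg (ha2 (by omega)).1, sign_pos (hb1 h5).1] at hs
      exact absurd hs (by decide)
  have all : ∀ k, |β * tailValue β a (n + k)| < gap β N ∧ |β * tailValue β b (n + k)| < gap β N ∧
      SignType.sign (tailValue β a (n + k)) = SignType.sign (tailValue β b (n + k)) := by
    intro k
    induction k with
    | zero => exact ⟨han, hbn, hsign⟩
    | succ k ih =>
      obtain ⟨hak, hbk, hs⟩ := ih
      have hd := digit _ hak hbk hs
      obtain ⟨ha0, ha1, ha2⟩ := ha.short_tail_step hN h0 h1 h2 hgβ hak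
      obtain ⟨hb0, hb1, hb2⟩ := hb.short_tail_step hN h0 h1 h2 hgβ hbk
      refine ⟨ha0, hb0, ?_⟩
      rw [← add_assoc]
      rcases lt_trichotomy (a (n + k)) 0 with h5 | h5 | h5
      · rw [sign_pos (ha2 h5).2, sign_pos (hb2 (hd ▸ h5)).2]
      · rw [tailValue_eq h0 hβ ha.1, tailValue_eq h0 hβ hb.1, ← hd, h5, Int.cast_zero, zero_add,
          zero_add, sign_mul, sign_mul, sign_pos h0, one_mul, one_mul] at hs
        exact hs
      · rw [sign_neg (ha1 h5).2, sign_neg (hb1 (hd ▸ h5)).2]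
  obtain ⟨k, rfl⟩ := Nat.exists_eq_add_of_le hl
  exact digit _ (all k).1 (all k).2.1 (all k).2.2

/-- A descent from the largest to the smallest digit is followed by a short tail. -/
theorem IsUniqueCode.short_tail_of_descent (hN : 2 ≤ N) (h0 : 0 < β) (h1 : N * β < 1)
    (h2 : 1 < (2 * (N : ℝ) - 1) * β) (hgβ : gap β N ≤ β) (ha : IsUniqueCode β N a) {n : ℕ}
    (hn : a n = (N : ℤ) - 1) (hn' : a (n + 1) = -((N : ℤ) - 1)) :
    |β * tailValue β a (n + 1 + 1)| < gap β N := by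
  have hN' : (2 : ℝ) ≤ N := by exact_mod_cast hN
  have h3 := ha.neg_gap_lt hN h0 h1 h2 (n := n) (by omega)
  have h4 := ha.lt_gap hN h0 h1 h2 (n := n + 1) (by omega)
  have heq := tailValue_eq h0 (beta_lt_one hN h1) ha.1 (n + 1)
  rw [hn'] at heq
  push_cast at heq
  have h5 : -1 < tailValue β a (n + 1) := by
    by_contra! h
    nlinarith
  have := gap_pos hN h1
  exact abs_lt.2 ⟨by linarith, h4⟩

theorem IsUniqueCode.exists_short_tail (hN : 2 ≤ N) (h0 : 0 < β) (h1 : N * β < 1)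
    (h2 : 1 < (2 * (N : ℝ) - 1) * β) (hgβ : gap β N ≤ β) (ha : IsUniqueCode β N a)
    (hp : a ≠ fun _ => (N : ℤ) - 1) (hm : a ≠ fun _ => -((N : ℤ) - 1)) :
    ∃ n, |β * tailValue β a n| < gap β N := by
  by_contra! hno
  have hext : ∀ n, a n = (N : ℤ) - 1 ∨ a n = -((N : ℤ) - 1) := by
    intro n
    by_contra! h
    obtain ⟨h3, h4⟩ := ha.1 n
    exact absurd (abs_lt.2 ⟨ha.neg_gap_lt hN h0 h1 h2 (n := n) (by omega),
      ha.lt_gap hN h0 h1 h2 (n := n) (by omega)⟩) (not_lt.2 (hno (n + 1)))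
  have hstep : ∀ n, a (n + 1) = a n := by
    intro n
    rcases hext n with h3 | h3 <;> rcases hext (n + 1) with h4 | h4
    · rw [h3, h4]
    · exact absurd (ha.short_tail_of_descent hN h0 h1 h2 hgβ h3 h4) (not_lt.2 (hno _))
    · have := ha.neg.short_tail_of_descent hN h0 h1 h2 hgβ (n := n) (by omega) (by omega)
      rw [tailValue_neg, mul_neg, abs_neg] at this
      exact absurd this (not_lt.2 (hno _))
    · rw [h3, h4]
  have hconst : ∀ n, a n = a 0 := by
    intro n
    induction n with
    | zero => rfl
    | succ n ih => rw [hstep, ih]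
  rcases hext 0 with h3 | h3
  · exact hp (funext fun n => (hconst n).trans h3)
  · exact hm (funext fun n => (hconst n).trans h3)

theorem selfSimilarSet_countable (hN : 2 ≤ N) (h0 : 0 < β) (h1 : N * β < 1)
    (h2 : 1 < (2 * (N : ℝ) - 1) * β) (hgβ : gap β N ≤ β) : (selfSimilarSet β N).Countable := by
  have hA : ∀ n : ℕ, {a | IsUniqueCode β N a ∧ (fun l => (a l).natAbs) ∈ eventuallyPeriodic ∧
      |β * tailValue β a n| < gap β N}.Countable := by
    intro n
    refine Set.MapsTo.countable_of_injOn
      (f := fun a => ((fun i : Fin n => a i, SignType.sign (tailValue β a n)),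
        fun l => (a l).natAbs))
      (t := Set.univ ×ˢ eventuallyPeriodic) (fun a ha => ⟨trivial, ha.2.1⟩) ?_
      (Set.countable_univ.prod countable_eventuallyPeriodic)
    rintro a ⟨ha, -, han⟩ b ⟨hb, -, hbn⟩ hab
    simp only [Prod.mk.injEq] at hab
    obtain ⟨⟨hpre, hsign⟩, habs⟩ := hab
    funext l
    by_cases hl : l < n
    · exact congrFun hpre ⟨l, hl⟩
    · exact ha.eq_of_natAbs_eq hN h0 h1 h2 hgβ hb han hbn hsign (congrFun habs) (not_lt.1 hl)
  refine (((Set.countable_iUnion hA).union (Set.to_countable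
    {(fun _ => (N : ℤ) - 1 : ℕ → ℤ), fun _ => -((N : ℤ) - 1)})).image (codeValue β N)).mono ?_
  intro t ht
  obtain ⟨a, ⟨ha, hss⟩, rfl⟩ := (mem_selfSimilarSet_iff hN h0 h1).1 ht
  refine ⟨a, ?_, rfl⟩
  by_cases hp : a = fun _ => (N : ℤ) - 1
  · exact Or.inr (Or.inl hp)
  by_cases hm : a = fun _ => -((N : ℤ) - 1)
  · exact Or.inr (Or.inr hm)
  obtain ⟨n, hn⟩ := ha.exists_short_tail hN h0 h1 h2 hgβ hp hm
  exact Or.inl (Set.mem_iUnion.2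
    ⟨n, ha, natAbs_mem_eventuallyPeriodic hN h0 h1 ha.1 hss, hn⟩)

end Signs

end HomCantor

theorem theorem5p1 (N : ℕ) (hN : 2 ≤ N) (β : ℝ)
    (hβ : β ∈ Set.Ioo (1 / (2 * (N : ℝ) - 1)) (1 / (N : ℝ))) :
    (β ∈ Set.Ioo (1 / (2 * (N : ℝ) - 1)) (HomCantor.alphaC N) →
      0 < dimH (HomCantor.selfSimilarSet β N)) ∧
    (β ∈ Set.Ico (HomCantor.alphaC N) (1 / (N : ℝ)) →
      Cardinal.mk (HomCantor.selfSimilarSet β N) = Cardinal.aleph0) := by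
  have hN' : (2 : ℝ) ≤ N := by exact_mod_cast hN
  have hd : (0 : ℝ) < 2 * N - 1 := by linarith
  have h0 : 0 < β := lt_trans (by positivity) hβ.1
  have h1 : N * β < 1 := by
    have := hβ.2
    rw [lt_div_iff₀ (by linarith)] at this
    linarith
  have h2 : 1 < (2 * (N : ℝ) - 1) * β := by
    have := hβ.1
    rw [div_lt_iff₀ hd] at this
    linarith
  refine ⟨fun h => HomCantor.dimH_selfSimilarSet_pos hN h0 h1 h.2, fun h => ?_⟩
  have hgβ : HomCantor.gap β N ≤ β :=
    not_lt.1 fun hlt => absurd ((HomCantor.lt_alphaC_iff hN h0 h1).2 hlt) (not_lt.2 h.1)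
  have hc := (HomCantor.selfSimilarSet_countable hN h0 h1 h2 hgβ).to_subtype
  have hi := (HomCantor.selfSimilarSet_infinite hN h0 h1).to_subtype
  exact Cardinal.mk_eq_aleph0 _
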